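/- Let $a<b$, $N\ge 0$ and $n=(n_0,\dots,n_N)\in\mathbb N^{N+1}$. Put $n_{\hat x}=\sum_{i=0}^N n_i$, $n_{S_i}=\sum_{j=i}^N n_j$, $n_S=\sum_{i=1}^N n_{S_i}$, and $W^n=\prod_{i=0}^N W_i^{n_i}[a,b]$, where $W_i[a,b]$ is the Sobolev space of functions whose weak derivatives of order $\le i$ lie in $L_2[a,b]$. For $\hat{\mathbf x}=(\hat{\mathbf x}_0,\dots,\hat{\mathbf x}_N)\in W^n$ let $S^i\hat{\mathbf x}=(\hat{\mathbf x}_i,\dots,\hat{\mathbf x}_N)$ and $$\mathcal F\hat{\mathbf x}=\mathrm{col}(\hat{\mathbf x},\partial_sS\hat{\mathbf x},\dots,\partial_s^NS^N\hat{\mathbf x}),\quad \mathcal C\hat{\mathbf x}=\mathrm{col}(S\hat{\mathbf x},\partial_sS^2\hat{\mathbf x},\dots,\partial_s^{N-1}S^N\hat{\mathbf x}),\quad \mathcal B\hat{\mathbf x}=\mathrm{col}\big((\mathcal C\hat{\mathbf x})(a),(\mathcal C\hat{\mathbf x})(b)\big),\quad \mathcal D\hat{\mathbf x}=\mathrm{col}(\hat{\mathbf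 x}_0,\partial_s\hat{\mathbf x}_1,\dots,\partial_s^N\hat{\mathbf x}_N).$$ (Continuous representatives are used in $\mathcal C\hat{\mathbf x}$.) **Signals.** $f\in L_{2e}[\mathbb R_+]$ means $f|_{[0,T]}\in L_2[0,T]$ for all $T\geq 0$; $f\in W_{1e}[\mathbb R_+]$ means that $f$ is continuous on $\mathbb R_+$ and $f|_{[0,T]}\in W_1[0,T]$ for all $T>0$. **PDE subsystem.** Let $B\in\mathbb R^{n_{BC}\times 2n_S}$, $B_v\in\mathbb R^{n_{BC}\times n_v}$, and let $B_I:[a,b]\to\mathbb R^{n_{BC}\times(n_S+n_{\hat x})}$ be square integrable. Let $A_0(s),A_1(s,\theta),A_2(s,\theta)\in\mathbb R^{n_{\hat x}\times(n_S+n_{\hat x})}$, $B_{xv}(s)\in\mathbb R^{n_{\hat x}\times n_v}$, $B_{xb}(s)\in\mathbb R^{n_{\hat x}\times 2n_S}$, $C_r(s)\in\mathbb R^{n_r\times(n_S+n_{\hat x})}$ be measurable and essentially bounded on $[a,b]$, resp. $[a,b]^2$, and let $D_{rb}\in\mathbb R^{n_r\times 2n_S}$. For $v\in\mathbb R^{n_v}$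 let $$X_v=\Big\{\hat{\mathbf x}\in W^n:\ \int_a^bB_I(s)(\mathcal F\hat{\mathbf x})(s)\,ds+B_vv-B\,\mathcal B\hat{\mathbf x}=0\Big\}.$$ For $v\in L_{2e}$ with $B_vv\in W_{1e}$ and $\hat{\mathbf x}^0\in X_{v(0)}$, $\{\hat{\mathbf x},r\}$ *satisfies the PDE* with initial condition $\hat{\mathbf x}^0$ and input $v$ if $r\in L_{2e}^{n_r}$, $\hat{\mathbf x}(t)\in X_{v(t)}$ for all $t\ge0$, $\hat{\mathbf x}(0)=\hat{\mathbf x}^0$, and for almost all $t\ge0$ the map $\hat{\mathbf x}$ is differentiable at $t$ in the $L_2$-norm and $$\dot{\hat{\mathbf x}}(t)=A_0\,\mathcal F\hat{\mathbf x}(t)+\int_a^sA_1(s,\theta)(\mathcal F\hat{\mathbf x}(t))(\theta)d\theta+\int_s^bA_2(s,\theta)(\mathcal F\hat{\mathbf x}(t))(\theta)d\theta+B_{xv}v(t)+B_{xb}\mathcal B\hat{\mathbf x}(t),\qquad r(t)=\int_a^bC_r\,\mathcal F\hat{\mathbf x}(t)\,ds+D_{rb}\mathcal B\hat{\mathbf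 x}(t).$$ **PIE subsystem.** For matrix functions write $(\mathcal P_{\{R_i\}}\mathbf u)(s)=R_0(s)\mathbf u(s)+\int_a^sR_1(s,\theta)\mathbf u(\theta)d\theta+\int_s^bR_2(s,\theta)\mathbf u(\theta)d\theta$, and let $\left[\begin{smallmatrix}P&Q_1\\Q_2&\{R_i\}\end{smallmatrix}\right]$ denote the operator $(v,\mathbf u)\mapsto\big(Pv+\int_a^bQ_1\mathbf u\,ds,\ Q_2v+\mathcal P_{\{R_i\}}\mathbf u\big)$. Given 3-PI operators $\hat{\mathcal T},\hat{\mathcal A}$, multiplication operators $\mathcal T_v,\mathcal B_v:\mathbb R^{n_v}\to L_2^{n_{\hat x}}$, an integral operator $\mathcal C_r:L_2^{n_{\hat x}}\to\mathbb R^{n_r}$ and a matrix $\mathcal D_{rv}$, and given $\underline{\mathbf x}^0\in L_2^{n_{\hat x}}$ and $v\in L_{2e}$ with $(\mathcal T_vv)(\cdot,s)\in W_{1e}$ for all $s\in[a,b]$, $\{\underline{\mathbf x},r\}$ *satisfies the PIE* with initial condition $\underline{\mathbf x}^0$ and input $v$ if $r\in L_{2e}$, $\underline{\mathbf x}(t)\in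 L_2^{n_{\hat x}}$ for all $t\ge0$, $\underline{\mathbf x}(0)=\underline{\mathbf x}^0$, and for almost all $t\ge0$ the maps $\hat{\mathcal T}\underline{\mathbf x}$ and $\mathcal T_vv$ are differentiable at $t$ in the $L_2$-norm and $$\partial_t(\hat{\mathcal T}\underline{\mathbf x})(t)=\hat{\mathcal A}\underline{\mathbf x}(t)+\mathcal B_vv(t)-\partial_t(\mathcal T_vv)(t),\qquad r(t)=\mathcal C_r\underline{\mathbf x}(t)+\mathcal D_{rv}v(t).$$ **The associated PIE.** Put $\tau_k(s)=s^k/k!$. Let $T(s)\in\mathbb R^{n_S\times n_S}$ be block upper triangular with blocks $T_{i,j}(s)=\tau_{j-i}(s)\left[\begin{smallmatrix}0\\I_{n_{S_j}}\end{smallmatrix}\right]\in\mathbb R^{n_{S_i}\times n_{S_j}}$, $1\le i\le j\le N$, and first block row $T_1$. Let $Q=\mathrm{col}(Q_1,\dots,Q_N)$, $Q_i(s)=[\,0\ \ \mathrm{diag}(\tau_0(s)I_{n_i},\dots,\tau_{N-i}(s)I_{n_N})\,]\in\mathbb R^{n_{S_i}\times n_{\hat x}}$. Let $U_1,U_2$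 be the 0-1 matrices with $\mathcal F\hat{\mathbf x}=U_1\mathcal D\hat{\mathbf x}+U_2\,\mathcal C\hat{\mathbf x}$: $U_1=\mathrm{diag}(U_{10},\dots,U_{1N})$, $U_2=\left[\begin{smallmatrix}\mathrm{diag}(U_{20},\dots,U_{2(N-1)})\\0\end{smallmatrix}\right]$, $U_{1i}=\left[\begin{smallmatrix}I_{n_i}\\0\end{smallmatrix}\right]$, $U_{2i}=\left[\begin{smallmatrix}0\\I_{n_{S_{i+1}}}\end{smallmatrix}\right]$. Let $$B_T=B\begin{bmatrix}T(0)\\T(b-a)\end{bmatrix}-\int_a^bB_I(s)U_2T(s-a)ds\in\mathbb R^{n_{BC}\times n_S}.$$ The pair $\{n,\{B,B_I,B_v\}\}$ is *admissible* if $B_T$ is invertible. Then let $$B_Q(s)=B_T^{-1}\Big(B_I(s)U_1+\int_s^bB_I(\theta)U_2Q(\theta-s)d\theta-B\begin{bmatrix}0\\Q(b-s)\end{bmatrix}\Big),$$ $$\hat{\mathcal T}=\mathcal P_{\{G_0,G_1,G_2\}},\quad G_0=\begin{bmatrix}I_{n_0}&0\\0&0\end{bmatrix},\quad G_2(s,\theta)=\begin{bmatrix}0\\T_1(s-a)B_Q(\theta)\end{bmatrix},\quad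 G_1(s,\theta)=\begin{bmatrix}0\\Q_1(s-\theta)\end{bmatrix}+G_2(s,\theta),\quad (\mathcal T_vv)(s)=\begin{bmatrix}0\\T_1(s-a)B_T^{-1}B_v\end{bmatrix}v,$$ and let $\{\hat{\mathcal A},\mathcal B_v,\mathcal C_r,\mathcal D_{rv}\}$ be the blocks of $$\begin{bmatrix}\mathcal D_{rv}&\mathcal C_r\\\mathcal B_v&\hat{\mathcal A}\end{bmatrix}=\left[\begin{array}{c|c}[\,0\ \ D_{rb}\,]&C_r\\\hline[\,B_{xv}\ \ B_{xb}\,]&\{A_i\}\end{array}\right]\circ\left[\begin{array}{c|c}\begin{bmatrix}I\\B_T^{-1}B_v\\T(b-a)B_T^{-1}B_v\end{bmatrix}&\begin{bmatrix}0\\B_Q(s)\\T(b-a)B_Q(s)+Q(b-s)\end{bmatrix}\\\hline U_2T(s-a)B_T^{-1}B_v&\{U_1,\ R_{D,1},\ R_{D,2}\}\end{array}\right],$$ where $R_{D,2}(s,\theta)=U_2T(s-a)B_Q(\theta)$, $R_{D,1}(s,\theta)=R_{D,2}(s,\theta)+U_2Q(s-\theta)$. The product of parameters $\left[\begin{smallmatrix}A&B_1\\B_2&\{C_i\}\end{smallmatrix}\right]\circ\left[\begin{smallmatrix}P&Q_1\\Q_2&\{R_i\}\end{smallmatrix}\right]=\left[\begin{smallmatrix}\hat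 P&\hat Q_1\\\hat Q_2&\{\hat R_i\}\end{smallmatrix}\right]$ (in this formula the letters denote arbitrary parameters) is given by $\hat P=AP+\int_a^bB_1Q_2\,ds$, $\hat R_0=C_0R_0$, $$\hat Q_1(s)=AQ_1(s)+B_1(s)R_0(s)+\int_s^bB_1(\eta)R_1(\eta,s)d\eta+\int_a^sB_1(\eta)R_2(\eta,s)d\eta,$$ $$\hat Q_2(s)=B_2(s)P+C_0(s)Q_2(s)+\int_a^sC_1(s,\eta)Q_2(\eta)d\eta+\int_s^bC_2(s,\eta)Q_2(\eta)d\eta,$$ $$\hat R_1(s,\eta)=B_2(s)Q_1(\eta)+C_0(s)R_1(s,\eta)+C_1(s,\eta)R_0(\eta)+\int_a^\eta C_1(s,\theta)R_2(\theta,\eta)d\theta+\int_\eta^sC_1(s,\theta)R_1(\theta,\eta)d\theta+\int_s^bC_2(s,\theta)R_1(\theta,\eta)d\theta,$$ $$\hat R_2(s,\eta)=B_2(s)Q_1(\eta)+C_0(s)R_2(s,\eta)+C_2(s,\eta)R_0(\eta)+\int_a^sC_1(s,\theta)R_2(\theta,\eta)d\theta+\int_s^\eta C_2(s,\theta)R_2(\theta,\eta)d\theta+\int_\eta^bC_2(s,\theta)R_1(\theta,\eta)d\theta.$$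 **Theorem.** Suppose $\{n,\{B,B_I,B_v\}\}$ is admissible and $v\in L_{2e}^{n_v}[\mathbb R_+]$ with $B_vv\in W_{1e}^{n_{BC}}[\mathbb R_+]$. Then: 1. For any $\hat{\mathbf x}^0\in X_{v(0)}$, if $\{\hat{\mathbf x},r\}$ satisfies the PDE with initial condition $\hat{\mathbf x}^0$ and input $v$, then $\{\mathcal D\hat{\mathbf x},r\}$ satisfies the associated PIE $\{\hat{\mathcal T},\mathcal T_v,\hat{\mathcal A},\mathcal B_v,\mathcal C_r,\mathcal D_{rv}\}$ with initial condition $\mathcal D\hat{\mathbf x}^0\in L_2^{n_{\hat x}}$ and input $v$. 2. For any $\underline{\mathbf x}^0\in L_2^{n_{\hat x}}$, if $\{\underline{\mathbf x},r\}$ satisfies the associated PIE with initial condition $\underline{\mathbf x}^0$ and input $v$, then $\{\hat{\mathcal T}\underline{\mathbf x}+\mathcal T_vv,\,r\}$ satisfies the PDE with initial condition $\hat{\mathcal T}\underline{\mathbf x}^0+\mathcal T_vv(0)$ and input $v$. -/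

import Mathlib

open MeasureTheory Filter Topology
open scoped Matrix ContDiff

namespace GPDE

noncomputable section

/-! ## Function spaces -/

/-- Lebesgue measure on the interval `[a,b]`. -/
abbrev vol (a b : ℝ) : Measure ℝ := volume.restrict (Set.Icc a b)

/-- The Hilbert space `L₂^ι[a,b]` of (classes of) square-integrable `ℝ^ι`-valued functions. -/
abbrev L2 (a b : ℝ) (ι : Type) [Fintype ι] : Type := Lp (EuclideanSpace ℝ ι) 2 (vol a b)

/-- A representative of an element of `L₂^ι[a,b]`, as a function `s ↦ (i ↦ u_i(s))`. -/
def fn {a b : ℝ} {ι : Type} [Fintype ι] (u : L2 a b ι) : ℝ → ι → ℝ := fun s i => u s i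

/-- Square integrability on `[a,b]` of an `ℝ^ι`-valued function. -/
def SqInt (a b : ℝ) {ι : Type} [Fintype ι] (f : ℝ → ι → ℝ) : Prop :=
  ∀ i, MemLp (fun s => f s i) 2 (vol a b)

theorem SqInt.memLp {a b : ℝ} {ι : Type} [Fintype ι] {f : ℝ → ι → ℝ} (h : SqInt a b f) :
    MemLp (fun s => (WithLp.toLp 2 (f s) : EuclideanSpace ℝ ι)) 2 (vol a b) :=
  MemLp.of_eval_piLp h

open Classical in
/-- The element of `L₂^ι[a,b]` given by a square-integrable function. (The value `0` for other
functions is never used: square integrability is part of every statement below.) -/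
def toL2 (a b : ℝ) {ι : Type} [Fintype ι] (f : ℝ → ι → ℝ) : L2 a b ι :=
  if h : SqInt a b f then h.memLp.toLp _ else 0

/-- `g` is a weak derivative of order `k` of `f` on the open interval `(a,b)`. -/
def IsWeakDeriv (a b : ℝ) (k : ℕ) (f g : ℝ → ℝ) : Prop :=
  ∀ φ : ℝ → ℝ, ContDiff ℝ ∞ φ → HasCompactSupport φ → tsupport φ ⊆ Set.Ioo a b →
    ∫ s in a..b, f s * iteratedDeriv k φ s = (-1) ^ k * ∫ s in a..b, g s * φ s

/-- Scalar Sobolev space `W_k[a,b]`: `f` and its weak derivatives of order `≤ k` lie in `L₂`. -/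
def MemW (a b : ℝ) (k : ℕ) (f : ℝ → ℝ) : Prop :=
  MemLp f 2 (vol a b) ∧ ∀ l ≤ k, ∃ g, MemLp g 2 (vol a b) ∧ IsWeakDeriv a b l f g

open Classical in
/-- The weak derivative `∂_s^k f` (unique almost everywhere on `[a,b]`). -/
def weakDeriv (a b : ℝ) (k : ℕ) (f : ℝ → ℝ) : ℝ → ℝ :=
  if h : ∃ g, MemLp g 2 (vol a b) ∧ IsWeakDeriv a b k f g then h.choose else 0

theorem memLp_weakDeriv (a b : ℝ) (k : ℕ) (f : ℝ → ℝ) :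
    MemLp (weakDeriv a b k f) 2 (vol a b) := by
  unfold weakDeriv
  split_ifs with h
  · exact h.choose_spec.1
  · exact MemLp.zero

open Classical in
/-- The continuous representative of `f` on `[a,b]` (unique on `[a,b]` when `a < b`); it exists
for every `f ∈ W_1[a,b]`. -/
def contRep (a b : ℝ) (f : ℝ → ℝ) : ℝ → ℝ :=
  if h : ∃ g : ℝ → ℝ, ContinuousOn g (Set.Icc a b) ∧ f =ᵐ[vol a b] g then h.choose else 0

/-- The extended space `L_{2e}[ℝ₊]`: square integrable on every `[0,T]`. -/
def MemL2e {ι : Type} [Fintype ι] (f : ℝ → ι → ℝ) : Prop := ∀ T : ℝ, 0 ≤ T → SqInt 0 T f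

/-- The extended space `W_{1e}[ℝ₊]`: the restriction to every `[0,T]` is in `W_1[0,T]`. As the
signals are evaluated at every time, `f` itself is its continuous representative. -/
def MemW1e {ι : Type} [Fintype ι] (f : ℝ → ι → ℝ) : Prop :=
  ContinuousOn f (Set.Ici 0) ∧ ∀ T : ℝ, 0 < T → ∀ i, MemW 0 T 1 (fun t => f t i)

/-! ## Partial integral operators -/

/-- Componentwise integral of a vector-valued function. -/
def vecInt (a b : ℝ) {ι : Type} (f : ℝ → ι → ℝ) : ι → ℝ := fun i => ∫ s in a..b, f s i

/-- Entrywise integral of a matrix-valued function. -/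
def matInt (a b : ℝ) {ι κ : Type} (M : ℝ → Matrix ι κ ℝ) : Matrix ι κ ℝ :=
  Matrix.of fun i j => ∫ s in a..b, M s i j

/-- Parameters `{R₀, R₁, R₂}` of a 3-PI operator. -/
structure ThreePI (p q : Type) where
  R0 : ℝ → Matrix p q ℝ
  R1 : ℝ → ℝ → Matrix p q ℝ
  R2 : ℝ → ℝ → Matrix p q ℝ

/-- The 3-PI operator: `R₀(s) f(s) + ∫_a^s R₁(s,θ) f(θ) dθ + ∫_s^b R₂(s,θ) f(θ) dθ`. -/
def ThreePI.apply {p q : Type} [Fintype q] (a b : ℝ) (R : ThreePI p q) (f : ℝ → q → ℝ) :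
    ℝ → p → ℝ := fun s =>
  R.R0 s *ᵥ f s + vecInt a s (fun θ => R.R1 s θ *ᵥ f θ) + vecInt s b (fun θ => R.R2 s θ *ᵥ f θ)

/-- Parameters `[P, Q₁; Q₂, {R_i}]` of a 4-PI operator `ℝ^k × L₂^q → ℝ^m × L₂^p`. -/
structure FourPI (m p k q : Type) where
  P : Matrix m k ℝ
  Q1 : ℝ → Matrix m q ℝ
  Q2 : ℝ → Matrix p k ℝ
  R : ThreePI p q

/-- The map `P_×^4`: the parameters of the composition of two 4-PI operators. -/
def FourPI.comp {m p l o k q : Type} [Fintype l] [Fintype o] (a b : ℝ)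
    (X : FourPI m p l o) (Y : FourPI l o k q) : FourPI m p k q where
  P := X.P * Y.P + matInt a b (fun s => X.Q1 s * Y.Q2 s)
  Q1 := fun s => X.P * Y.Q1 s + X.Q1 s * Y.R.R0 s
    + matInt s b (fun η => X.Q1 η * Y.R.R1 η s) + matInt a s (fun η => X.Q1 η * Y.R.R2 η s)
  Q2 := fun s => X.Q2 s * Y.P + X.R.R0 s * Y.Q2 s
    + matInt a s (fun η => X.R.R1 s η * Y.Q2 η) + matInt s b (fun η => X.R.R2 s η * Y.Q2 η)
  R :=
    { R0 := fun s => X.R.R0 s * Y.R.R0 s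
      R1 := fun s η => X.Q2 s * Y.Q1 η + X.R.R0 s * Y.R.R1 s η + X.R.R1 s η * Y.R.R0 η
        + matInt a η (fun θ => X.R.R1 s θ * Y.R.R2 θ η)
        + matInt η s (fun θ => X.R.R1 s θ * Y.R.R1 θ η)
        + matInt s b (fun θ => X.R.R2 s θ * Y.R.R1 θ η)
      R2 := fun s η => X.Q2 s * Y.Q1 η + X.R.R0 s * Y.R.R2 s η + X.R.R2 s η * Y.R.R0 η
        + matInt a s (fun θ => X.R.R1 s θ * Y.R.R2 θ η)
        + matInt s η (fun θ => X.R.R2 s θ * Y.R.R2 θ η)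
        + matInt η b (fun θ => X.R.R2 s θ * Y.R.R1 θ η) }

/-! ## PIE subsystems -/

/-- Parameters of a PIE subsystem
`∂ₜ(T x) = A x + B_v v - ∂ₜ(T_v v)`, `r = C_r x + D_rv v` with input `v(t) ∈ ℝ^ν`, state
`x(t) ∈ L₂^σ[a,b]` and output `r(t) ∈ ℝ^ρ`: `T`, `A` are 3-PI operators, `T_v`, `B_v` are
multiplication operators `ℝ^ν → L₂^σ`, `C_r` is an integral operator `L₂^σ → ℝ^ρ` and `D_rv` is
a matrix. (All other blocks of a general PIE system are empty.) -/
structure PIESubsystem (σ ν ρ : Type) where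
  T : ThreePI σ σ
  Tv : ℝ → Matrix σ ν ℝ
  A : ThreePI σ σ
  Bv : ℝ → Matrix σ ν ℝ
  Cr : ℝ → Matrix ρ σ ℝ
  Drv : Matrix ρ ν ℝ

/-- `{x, r}` satisfies the PIE subsystem `G` with initial condition `x0` and input `v`.
Differentiability of `x` with respect to the `T`-norm `‖x‖_T = ‖T x‖_{L₂}` at time `t` means that
`T x` is differentiable at `t` with respect to the `L₂`-norm; its derivative is denoted `T ẋ`. In
the same way `T_v v̇` is the time derivative of `T_v v`. -/
def IsPIESolution {σ ν ρ : Type} [Fintype σ] [Fintype ν] [Fintype ρ] (a b : ℝ)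
    (G : PIESubsystem σ ν ρ) (x0 : L2 a b σ) (v : ℝ → ν → ℝ)
    (x : ℝ → L2 a b σ) (r : ℝ → ρ → ℝ) : Prop :=
  MemL2e v ∧
  (∀ s ∈ Set.Icc a b, MemW1e (fun t => G.Tv s *ᵥ v t)) ∧
  MemL2e r ∧
  x 0 = x0 ∧
  (∀ t : ℝ, 0 ≤ t → SqInt a b (G.T.apply a b (fn (x t)))) ∧
  (∀ t : ℝ, 0 ≤ t → SqInt a b (fun s => G.Tv s *ᵥ v t)) ∧
  ∀ᵐ t ∂(volume.restrict (Set.Ici (0 : ℝ))), ∃ Tx' Tv' : L2 a b σ,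
    HasDerivWithinAt (fun τ => toL2 a b (G.T.apply a b (fn (x τ)))) Tx' (Set.Ici 0) t ∧
    HasDerivWithinAt (fun τ => toL2 a b (fun s => G.Tv s *ᵥ v τ)) Tv' (Set.Ici 0) t ∧
    (∀ᵐ s ∂(vol a b),
      fn Tx' s = G.A.apply a b (fn (x t)) s + G.Bv s *ᵥ v t - fn Tv' s) ∧
    r t = vecInt a b (fun s => G.Cr s *ᵥ fn (x t) s) + G.Drv *ᵥ v t

/-! ## The PDE subsystem -/

section PDE

variable {N : ℕ}

/-- Components of the state `x = (x_0,…,x_N)`, where `x_i` has `n_i` components and `i` weak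
derivatives: the pair `⟨i, c⟩` is component `c` of `x_i`. There are `n_x` of them. -/
abbrev StateIdx (n : Fin (N + 1) → ℕ) : Type := Σ i : Fin (N + 1), Fin (n i)

/-- Entries of `F x`: the pair `(j, p)` stands for `∂_s^j x_p`, where `j ≤` level of `p`.
There are `n_S + n_x` of them. -/
abbrev DerivIdx (n : Fin (N + 1) → ℕ) : Type :=
  {q : Fin (N + 1) × StateIdx n // (q.1 : ℕ) ≤ (q.2.1 : ℕ)}

/-- Entries of `C x`: the pair `(j, p)` stands for `∂_s^j x_p`, where `j <` level of `p`.
There are `n_S` of them. -/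
abbrev CoreIdx (n : Fin (N + 1) → ℕ) : Type :=
  {q : Fin N × StateIdx n // (q.1 : ℕ) < (q.2.1 : ℕ)}

variable {n : Fin (N + 1) → ℕ} {a b : ℝ}

/-- `W^n[a,b] = ∏ W_i^{n_i}[a,b]`. -/
def Wn (n : Fin (N + 1) → ℕ) (a b : ℝ) : Set (L2 a b (StateIdx n)) :=
  {x | ∀ p : StateIdx n, MemW a b (p.1 : ℕ) (fun s => fn x s p)}

/-- `F x`, the list of all partial derivatives of `x`. -/
def FF (x : L2 a b (StateIdx n)) : ℝ → DerivIdx n → ℝ :=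
  fun s q => weakDeriv a b (q.1.1 : ℕ) (fun s' => fn x s' q.1.2) s

/-- `C x`, the list of all absolutely continuous functions generated by `x`. -/
def CC (x : L2 a b (StateIdx n)) : ℝ → CoreIdx n → ℝ :=
  fun s q => contRep a b (weakDeriv a b (q.1.1 : ℕ) (fun s' => fn x s' q.1.2)) s

/-- `B x = ((C x)(a), (C x)(b))`, the list of all boundary values. -/
def BB (x : L2 a b (StateIdx n)) : CoreIdx n ⊕ CoreIdx n → ℝ :=
  Sum.elim (CC x a) (CC x b)

/-- `D x = (x_0, ∂_s x_1, …, ∂_s^N x_N)`. -/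
def DD (x : L2 a b (StateIdx n)) : L2 a b (StateIdx n) :=
  toL2 a b (fun s p => weakDeriv a b (p.1 : ℕ) (fun s' => fn x s' p) s)

/-- Boundary condition parameters `G_b = {B, B_I, B_v}` with `nBC` conditions and `nv` inputs. -/
structure BCParams (n : Fin (N + 1) → ℕ) (nBC nv : ℕ) where
  B : Matrix (Fin nBC) (CoreIdx n ⊕ CoreIdx n) ℝ
  BI : ℝ → Matrix (Fin nBC) (DerivIdx n) ℝ
  Bv : Matrix (Fin nBC) (Fin nv) ℝ

/-- In-domain parameters `G_p = {A₀, A₁, A₂, B_xv, B_xb, C_r, D_rb}`. -/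
structure PDEParams (n : Fin (N + 1) → ℕ) (nv nr : ℕ) where
  A : ThreePI (StateIdx n) (DerivIdx n)
  Bxv : ℝ → Matrix (StateIdx n) (Fin nv) ℝ
  Bxb : ℝ → Matrix (StateIdx n) (CoreIdx n ⊕ CoreIdx n) ℝ
  Cr : ℝ → Matrix (Fin nr) (DerivIdx n) ℝ
  Drb : Matrix (Fin nr) (CoreIdx n ⊕ CoreIdx n) ℝ

variable {nBC nv nr : ℕ}

/-- `B_I` is square integrable on `[a,b]`. -/
def BCParams.SquareIntegrable (a b : ℝ) (Gb : BCParams n nBC nv) : Prop :=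
  ∀ i j, MemLp (fun s => Gb.BI s i j) 2 (vol a b)

/-- The in-domain parameters are measurable and essentially bounded, on `[a,b]` and `[a,b]²`. -/
structure PDEParams.EssBounded (a b : ℝ) (Gp : PDEParams n nv nr) : Prop where
  A0 : ∀ i j, MemLp (fun s => Gp.A.R0 s i j) ⊤ (vol a b)
  A1 : ∀ i j, MemLp (fun z : ℝ × ℝ => Gp.A.R1 z.1 z.2 i j) ⊤ ((vol a b).prod (vol a b))
  A2 : ∀ i j, MemLp (fun z : ℝ × ℝ => Gp.A.R2 z.1 z.2 i j) ⊤ ((vol a b).prod (vol a b))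
  Bxv : ∀ i j, MemLp (fun s => Gp.Bxv s i j) ⊤ (vol a b)
  Bxb : ∀ i j, MemLp (fun s => Gp.Bxb s i j) ⊤ (vol a b)
  Cr : ∀ i j, MemLp (fun s => Gp.Cr s i j) ⊤ (vol a b)

/-- The set `X_v` of admissible states:
`x ∈ W^n` with `∫_a^b B_I(s) (F x)(s) ds + B_v v - B (B x) = 0`. -/
def BCParams.X (a b : ℝ) (Gb : BCParams n nBC nv) (v : Fin nv → ℝ) :
    Set (L2 a b (StateIdx n)) :=
  {x | x ∈ Wn n a b ∧
    vecInt a b (fun s => Gb.BI s *ᵥ FF x s) + Gb.Bv *ᵥ v - Gb.B *ᵥ BB x = 0}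

/-- `{x, r}` satisfies the PDE subsystem `{n, G_b, G_p}` with initial condition `x0` and
input `v`. -/
def IsPDESolution (a b : ℝ) (Gb : BCParams n nBC nv) (Gp : PDEParams n nv nr)
    (x0 : L2 a b (StateIdx n)) (v : ℝ → Fin nv → ℝ)
    (x : ℝ → L2 a b (StateIdx n)) (r : ℝ → Fin nr → ℝ) : Prop :=
  x0 ∈ Gb.X a b (v 0) ∧
  MemL2e v ∧
  MemW1e (fun t => Gb.Bv *ᵥ v t) ∧
  MemL2e r ∧
  (∀ t : ℝ, 0 ≤ t → x t ∈ Gb.X a b (v t)) ∧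
  x 0 = x0 ∧
  ∀ᵐ t ∂(volume.restrict (Set.Ici (0 : ℝ))), ∃ x' : L2 a b (StateIdx n),
    HasDerivWithinAt x x' (Set.Ici 0) t ∧
    (∀ᵐ s ∂(vol a b),
      fn x' s = Gp.A.apply a b (FF (x t)) s + Gp.Bxv s *ᵥ v t + Gp.Bxb s *ᵥ BB (x t)) ∧
    r t = vecInt a b (fun s => Gp.Cr s *ᵥ FF (x t) s) + Gp.Drb *ᵥ BB (x t)

/-! ## The associated PIE subsystem -/

/-- `τ_k(s) = s^k / k!`. -/
def tau (k : ℕ) (s : ℝ) : ℝ := s ^ k / (k.factorial : ℝ)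

/-- The matrix `T(s)`: its block from `∂_s^{j'}` to `∂_s^j`, `j ≤ j'`, is `τ_{j'-j}(s)` times
the inclusion of the states of level `> j'` in those of level `> j`. -/
def TT (n : Fin (N + 1) → ℕ) (s : ℝ) : Matrix (CoreIdx n) (CoreIdx n) ℝ :=
  Matrix.of fun q q' =>
    if q.1.2 = q'.1.2 ∧ q.1.1 ≤ q'.1.1 then tau ((q'.1.1 : ℕ) - (q.1.1 : ℕ)) s else 0

/-- The matrix `Q(s)`: the row of `∂_s^j x_p` has the single entry `τ_{i-1-j}(s)`, in column `p`,
where `i > j` is the level of `p`. -/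
def QQ (n : Fin (N + 1) → ℕ) (s : ℝ) : Matrix (CoreIdx n) (StateIdx n) ℝ :=
  Matrix.of fun q p => if q.1.2 = p then tau ((p.1 : ℕ) - 1 - (q.1.1 : ℕ)) s else 0

/-- The 0-1 matrix `U₁`, which places `∂_s^i x_i` in `F x`. -/
def U1 (n : Fin (N + 1) → ℕ) : Matrix (DerivIdx n) (StateIdx n) ℝ :=
  Matrix.of fun q p => if q.1.2 = p ∧ q.1.1 = p.1 then 1 else 0

/-- The 0-1 matrix `U₂`, which places `C x` in `F x`. -/
def U2 (n : Fin (N + 1) → ℕ) : Matrix (DerivIdx n) (CoreIdx n) ℝ :=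
  Matrix.of fun q q' => if q.1.2 = q'.1.2 ∧ (q.1.1 : ℕ) = (q'.1.1 : ℕ) then 1 else 0

/-- `[0; M₁]`, where `M₁` is the first block row of `M` (the rows of `∂_s^0 x_p`, `p` of
level `≥ 1`) and the zero rows are those of level `0`. -/
def padFirst {κ : Type} (M : Matrix (CoreIdx n) κ ℝ) : Matrix (StateIdx n) κ ℝ :=
  Matrix.of fun p c =>
    if h : 0 < (p.1 : ℕ) then
      M ⟨(⟨0, lt_of_lt_of_le h (Nat.lt_succ_iff.mp p.1.isLt)⟩, p), h⟩ c
    else 0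

namespace BCParams

/-- `B_T = B [T(0); T(b-a)] - ∫_a^b B_I(s) U₂ T(s-a) ds`. -/
def BT (a b : ℝ) (Gb : BCParams n nBC nv) : Matrix (Fin nBC) (CoreIdx n) ℝ :=
  Gb.B * Matrix.fromRows (TT n 0) (TT n (b - a))
    - matInt a b (fun s => Gb.BI s * U2 n * TT n (s - a))

/-- `{n, G_b}` is admissible: `B_T` is invertible (as a matrix in `ℝ^{nBC × n_S}`, so that in
particular `nBC = n_S`). -/
def Admissible (a b : ℝ) (Gb : BCParams n nBC nv) : Prop :=
  ∃ M : Matrix (CoreIdx n) (Fin nBC) ℝ, M * Gb.BT a b = 1 ∧ Gb.BT a b * M = 1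

open Classical in
/-- `B_T⁻¹` (for admissible parameters). -/
def BTinv (a b : ℝ) (Gb : BCParams n nBC nv) : Matrix (CoreIdx n) (Fin nBC) ℝ :=
  if h : Gb.Admissible a b then h.choose else 0

/-- `B_Q(s) = B_T⁻¹ (B_I(s) U₁ + ∫_s^b B_I(θ) U₂ Q(θ-s) dθ - B [0; Q(b-s)])`. -/
def BQ (a b : ℝ) (Gb : BCParams n nBC nv) (s : ℝ) : Matrix (CoreIdx n) (StateIdx n) ℝ :=
  Gb.BTinv a b * (Gb.BI s * U1 n + matInt s b (fun θ => Gb.BI θ * U2 n * QQ n (θ - s))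
    - Gb.B * Matrix.fromRows 0 (QQ n (b - s)))

/-- `G_v(s) = [0; T₁(s-a) B_T⁻¹ B_v]`, the kernel of `T_v`. -/
def Gv (a b : ℝ) (Gb : BCParams n nBC nv) (s : ℝ) : Matrix (StateIdx n) (Fin nv) ℝ :=
  padFirst (TT n (s - a) * Gb.BTinv a b * Gb.Bv)

/-- The parameters `{G₀, G₁, G₂}` of the 3-PI operator `T̂`: `G₀ = diag(I_{n_0}, 0)`,
`G₂(s,θ) = [0; T₁(s-a) B_Q(θ)]`, `G₁(s,θ) = [0; Q₁(s-θ)] + G₂(s,θ)`. -/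
def That (a b : ℝ) (Gb : BCParams n nBC nv) : ThreePI (StateIdx n) (StateIdx n) where
  R0 := fun _ => Matrix.diagonal fun p => if (p.1 : ℕ) = 0 then 1 else 0
  R1 := fun s θ => padFirst (QQ n (s - θ)) + padFirst (TT n (s - a) * Gb.BQ a b θ)
  R2 := fun s θ => padFirst (TT n (s - a) * Gb.BQ a b θ)

/-- The parameters `Υ` of the 4-PI operator that sends `(v, D x)` to `((v, B x), F x)`. -/
def Upsilon (a b : ℝ) (Gb : BCParams n nBC nv) :
    FourPI (Fin nv ⊕ (CoreIdx n ⊕ CoreIdx n)) (DerivIdx n) (Fin nv) (StateIdx n) where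
  P := Matrix.fromRows 1 (Matrix.fromRows (Gb.BTinv a b * Gb.Bv)
    (TT n (b - a) * Gb.BTinv a b * Gb.Bv))
  Q1 := fun s => Matrix.fromRows 0 (Matrix.fromRows (Gb.BQ a b s)
    (TT n (b - a) * Gb.BQ a b s + QQ n (b - s)))
  Q2 := fun s => U2 n * TT n (s - a) * Gb.BTinv a b * Gb.Bv
  R :=
    { R0 := fun _ => U1 n
      R1 := fun s θ => U2 n * TT n (s - a) * Gb.BQ a b θ + U2 n * QQ n (s - θ)
      R2 := fun s θ => U2 n * TT n (s - a) * Gb.BQ a b θ }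

end BCParams

/-- The parameters `Ξ = [[0, D_rb], C_r; [B_xv, B_xb], {A_i}]`. -/
def PDEParams.Xi (Gp : PDEParams n nv nr) :
    FourPI (Fin nr) (StateIdx n) (Fin nv ⊕ (CoreIdx n ⊕ CoreIdx n)) (DerivIdx n) where
  P := Matrix.fromCols 0 Gp.Drb
  Q1 := Gp.Cr
  Q2 := fun s => Matrix.fromCols (Gp.Bxv s) (Gp.Bxb s)
  R := Gp.A

/-- The PIE subsystem `{T̂, T_v, Â, B_v, C_r, D_rv}` associated with `{n, G_b, G_p}`, where
`[D_rv, C_rx; B_xv, {Â_i}] = P_×^4(Ξ, Υ)`. -/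
def toPIE (a b : ℝ) (Gb : BCParams n nBC nv) (Gp : PDEParams n nv nr) :
    PIESubsystem (StateIdx n) (Fin nv) (Fin nr) where
  T := Gb.That a b
  Tv := Gb.Gv a b
  A := (Gp.Xi.comp a b (Gb.Upsilon a b)).R
  Bv := (Gp.Xi.comp a b (Gb.Upsilon a b)).Q2
  Cr := (Gp.Xi.comp a b (Gb.Upsilon a b)).Q1
  Drv := (Gp.Xi.comp a b (Gb.Upsilon a b)).P

/-- The map `x ↦ T̂ x + T_v v` from PIE states to PDE states. -/
def PIEtoPDE (a b : ℝ) (Gb : BCParams n nBC nv) (v : Fin nv → ℝ) (x : L2 a b (StateIdx n)) :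
    L2 a b (StateIdx n) :=
  toL2 a b (fun s => (Gb.That a b).apply a b (fn x) s + Gb.Gv a b s *ᵥ v)

end PDE

end

end GPDE

namespace GPDE

noncomputable section

/-! ## Integrals over subintervals and triangles -/

/-! The theorem is Taylor's formula with integral remainder, followed by the solution of a finite
linear system.

A state in `W^n` is the same thing as a pair `(u, c)`: its highest derivatives `u = D x`, arbitrary
in L₂, and its values `c = (C x)(a)`, arbitrary vectors. In these terms `C x` is `taylor a u c`, `F
x` is `jet a u c` and `B x` is `boundaryValues a b u c`. That every state has this form
(`exists_jetState_of_mem_Wn`) rests on du Bois-Reymond's lemma; that every such pair gives a state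
(`isWeakDeriv_jet`) rests on `taylor_eq_primitive`.

Substituting `jet` into an integral functional and exchanging integrals over a triangle
(`vecInt_mulVec_jet`) makes it a matrix applied to `c` plus an integral of a kernel against `u`. For
the boundary condition the matrix acting on `c` is `-B_T`. Invertibility of `B_T` therefore fixes
`c` uniquely as `leftValues`, an affine function of `v` and `u` (`mem_X_iff`). Hence `u ↦ T̂ u + T_v
v` is a bijection from L₂ onto `X_v` with inverse `D` (`PIEtoPDE_mem_X`, `PIEtoPDE_DD`).

The same substitution in the dynamics and the output, together with this value of `c`, reproduces
the product of parameters (`dynamics_eq`, `output_eq`). For the dynamics `s` is frozen and the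
kernels `A₁(s,·)`, `A₂(s,·)` are glued into one kernel on `[a,b]`, so that the lemma on functionals
applies again.

For the time derivatives, `T̂ u = x - T_v v`, and `T_v v` is a fixed linear image of the
finite-dimensional signal `B_v v`, which is differentiable almost everywhere because it is in
`W_{1e}`. -/

theorem ae_vol_of_forall {a b : ℝ} {p : ℝ → Prop} (h : ∀ s ∈ Set.Icc a b, p s) :
    ∀ᵐ s ∂(vol a b), p s := by
  filter_upwards [ae_restrict_mem measurableSet_Icc] with s hs using h s hs

theorem intervalIntegrable_of_vol {a b c d : ℝ} {f : ℝ → ℝ} (hf : Integrable f (vol a b))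
    (hc : c ∈ Set.Icc a b) (hd : d ∈ Set.Icc a b) : IntervalIntegrable f volume c d :=
  (IntegrableOn.mono_set hf (Set.uIcc_subset_Icc hc hd)).intervalIntegrable

theorem integral_eq_vol {a b : ℝ} (hab : a ≤ b) (f : ℝ → ℝ) :
    ∫ s in a..b, f s = ∫ s, f s ∂(vol a b) := by
  rw [intervalIntegral.integral_of_le hab, ← integral_Icc_eq_integral_Ioc]

theorem integral_congr_vol {a b : ℝ} (hab : a ≤ b) {f g : ℝ → ℝ} (h : f =ᵐ[vol a b] g) :
    ∫ s in a..b, f s = ∫ s in a..b, g s := by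
  rw [integral_eq_vol hab, integral_eq_vol hab, integral_congr_ae h]

theorem integral_congr_vol_left {a b s : ℝ} (hs : s ∈ Set.Icc a b) {f g : ℝ → ℝ}
    (h : f =ᵐ[vol a b] g) : ∫ η in a..s, f η = ∫ η in a..s, g η :=
  integral_congr_vol hs.1
    (ae_restrict_of_ae_restrict_of_subset (Set.Icc_subset_Icc_right hs.2) h)

theorem integral_left_eq_vol {a b s : ℝ} (hs : s ∈ Set.Icc a b) (f : ℝ → ℝ) :
    ∫ η in a..s, f η = ∫ η, (if η ≤ s then f η else 0) ∂(vol a b) := by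
  have : (fun η => if η ≤ s then f η else 0) = (Set.Iic s).indicator f := by
    ext η; simp [Set.indicator]
  rw [this, integral_indicator measurableSet_Iic, integral_eq_vol hs.1,
    Measure.restrict_restrict measurableSet_Iic,
    show Set.Iic s ∩ Set.Icc a b = Set.Icc a s from Set.ext fun η =>
      ⟨fun h => ⟨h.2.1, h.1⟩, fun h => ⟨h.2, h.1, h.2.trans hs.2⟩⟩]

theorem integral_right_eq_vol {a b s : ℝ} (hs : s ∈ Set.Icc a b) (f : ℝ → ℝ) :
    ∫ η in s..b, f η = ∫ η, (if s ≤ η then f η else 0) ∂(vol a b) := by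
  have : (fun η => if s ≤ η then f η else 0) = (Set.Ici s).indicator f := by
    ext η; simp [Set.indicator]
  rw [this, integral_indicator measurableSet_Ici, integral_eq_vol hs.2,
    Measure.restrict_restrict measurableSet_Ici,
    show Set.Ici s ∩ Set.Icc a b = Set.Icc s b from Set.ext fun η =>
      ⟨fun h => ⟨h.1, h.2.2⟩, fun h => ⟨h.1, hs.1.trans h.1, h.2⟩⟩]

theorem memLp_top_of_continuous (a b : ℝ) {f : ℝ → ℝ} (hf : Continuous f) :
    MemLp f ⊤ (vol a b) := by
  obtain ⟨C, hC⟩ := isCompact_Icc.exists_bound_of_continuousOn (s := Set.Icc a b) hf.continuousOn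
  exact memLp_top_of_bound hf.aestronglyMeasurable C (ae_vol_of_forall hC)

/-- The integral is at most `C` times the L₁ norm of `u`; measurability in `s` comes from joint
measurability of the integrand. -/
theorem memLp_top_integral_kernel {a b : ℝ} {K : ℝ → ℝ → ℝ} {C : ℝ} {u : ℝ → ℝ}
    (hK : AEStronglyMeasurable (fun z : ℝ × ℝ => K z.1 z.2) ((vol a b).prod (vol a b)))
    (hC : ∀ s ∈ Set.Icc a b, ∀ η ∈ Set.Icc a b, |K s η| ≤ C) (hu : Integrable u (vol a b)) :
    MemLp (fun s => ∫ η, K s η * u η ∂(vol a b)) ⊤ (vol a b) := by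
  have hm : AEStronglyMeasurable (fun z : ℝ × ℝ => K z.1 z.2 * u z.2)
      ((vol a b).prod (vol a b)) := hK.mul hu.aestronglyMeasurable.comp_snd
  refine memLp_top_of_bound hm.integral_prod_right' (C * ∫ η, ‖u η‖ ∂(vol a b))
    (ae_vol_of_forall fun s hs => ?_)
  rw [← integral_const_mul]
  refine norm_integral_le_of_norm_le (hu.norm.const_mul C) (ae_vol_of_forall fun η hη => ?_)
  rw [norm_mul]
  exact mul_le_mul_of_nonneg_right (hC s hs η hη) (norm_nonneg _)

theorem measurable_triangle {κ : ℝ → ℝ} (hκ : Continuous κ) :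
    Measurable (fun z : ℝ × ℝ => if z.2 ≤ z.1 then κ (z.1 - z.2) else 0) :=
  Measurable.ite (measurableSet_le measurable_snd measurable_fst)
    (hκ.measurable.comp (measurable_fst.sub measurable_snd)) measurable_const

theorem exists_bound_triangle {κ : ℝ → ℝ} (hκ : Continuous κ) (a b : ℝ) :
    ∃ C, ∀ s ∈ Set.Icc a b, ∀ η ∈ Set.Icc a b,
      |if η ≤ s then κ (s - η) else 0| ≤ C := by
  obtain ⟨C, hC⟩ := isCompact_Icc.exists_bound_of_continuousOn (s := Set.Icc (a - b) (b - a))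
    hκ.continuousOn
  refine ⟨max C 0, fun s hs η hη => ?_⟩
  split_ifs
  · exact (hC _ ⟨by linarith [hs.1, hη.2], by linarith [hs.2, hη.1]⟩).trans (le_max_left _ _)
  · simp

/-- A Volterra integral of an integrable function is bounded. -/
theorem memLp_top_volterra_left {a b : ℝ} {κ : ℝ → ℝ} (hκ : Continuous κ) {u : ℝ → ℝ}
    (hu : Integrable u (vol a b)) :
    MemLp (fun s => ∫ η in a..s, κ (s - η) * u η) ⊤ (vol a b) := by
  obtain ⟨C, hC⟩ := exists_bound_triangle hκ a b
  refine (memLp_congr_ae (ae_vol_of_forall fun s hs => ?_)).1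
    (memLp_top_integral_kernel (measurable_triangle hκ).aestronglyMeasurable hC hu)
  simp only [integral_left_eq_vol hs, ite_mul, zero_mul]

theorem memLp_top_volterra_right {a b : ℝ} {κ : ℝ → ℝ} (hκ : Continuous κ) {d : ℝ → ℝ}
    (hd : Integrable d (vol a b)) :
    MemLp (fun η => ∫ θ in η..b, d θ * κ (θ - η)) ⊤ (vol a b) := by
  obtain ⟨C, hC⟩ := exists_bound_triangle hκ a b
  have hm := (measurable_triangle hκ).comp measurable_swap
  refine (memLp_congr_ae (ae_vol_of_forall fun s hs => ?_)).1
    (memLp_top_integral_kernel (K := fun η θ => if η ≤ θ then κ (θ - η) else 0)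
      hm.aestronglyMeasurable (fun s hs η hη => hC η hη s hs) hd)
  simp only [integral_right_eq_vol hs, ite_mul, zero_mul, mul_comm (d _)]

/-- Exchange of the order of integration on the triangle `a ≤ η ≤ s ≤ b`. -/
theorem integral_mul_volterra {a b : ℝ} (hab : a ≤ b) {κ : ℝ → ℝ} (hκ : Continuous κ)
    {d u : ℝ → ℝ} (hd : Integrable d (vol a b)) (hu : Integrable u (vol a b)) :
    ∫ s in a..b, d s * ∫ η in a..s, κ (s - η) * u η
      = ∫ η in a..b, (∫ θ in η..b, d θ * κ (θ - η)) * u η := by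
  obtain ⟨C, hC⟩ := exists_bound_triangle hκ a b
  have hint : Integrable (fun z : ℝ × ℝ => (if z.2 ≤ z.1 then κ (z.1 - z.2) else 0)
      * (d z.1 * u z.2)) ((vol a b).prod (vol a b)) := by
    -- On the square the integrand is a bounded kernel times a product of two L₁ functions, so L₁
    -- data suffice for Fubini.
    refine (hd.mul_prod hu).bdd_mul (c := C) (measurable_triangle hκ).aestronglyMeasurable ?_
    rw [Measure.prod_restrict]
    filter_upwards [ae_restrict_mem (measurableSet_Icc.prod measurableSet_Icc)] with z hz
    exact hC _ hz.1 _ hz.2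
  rw [integral_eq_vol hab, integral_eq_vol hab]
  have h := integral_integral_swap (f := fun s η => (if η ≤ s then κ (s - η) else 0)
      * (d s * u η)) hint
  convert h using 1
  · refine integral_congr_ae (ae_vol_of_forall fun s hs => ?_)
    simp only [integral_left_eq_vol hs]
    rw [← integral_const_mul]
    congr 1; ext η; split_ifs <;> ring
  · refine integral_congr_ae (ae_vol_of_forall fun η hη => ?_)
    simp only [integral_right_eq_vol hη]
    rw [← integral_mul_const]
    congr 1; ext s; split_ifs <;> ring

theorem continuousOn_primitive_vol {a b : ℝ} {u : ℝ → ℝ} (hu : Integrable u (vol a b)) :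
    ContinuousOn (fun s => ∫ η in a..s, u η) (Set.Icc a b) :=
  (intervalIntegral.continuousOn_primitive hu).congr fun s hs => by
    rw [intervalIntegral.integral_of_le hs.1]

/-! ## Weak derivatives -/

theorem isWeakDeriv_congr {a b : ℝ} (hab : a ≤ b) {k : ℕ} {f f' g g' : ℝ → ℝ}
    (hf : f =ᵐ[vol a b] f') (hg : g =ᵐ[vol a b] g') (h : IsWeakDeriv a b k f g) :
    IsWeakDeriv a b k f' g' := by
  intro φ h1 h2 h3
  have := h φ h1 h2 h3
  rw [integral_congr_vol hab (g := fun s => f' s * iteratedDeriv k φ s)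
      (by filter_upwards [hf] with s hs; rw [hs]),
    integral_congr_vol hab (f := fun s => g s * φ s) (g := fun s => g' s * φ s)
      (by filter_upwards [hg] with s hs; rw [hs])] at this
  exact this

theorem isWeakDeriv_zero (a b : ℝ) (f : ℝ → ℝ) : IsWeakDeriv a b 0 f f := by
  intro φ _ _ _; simp

theorem tsupport_deriv_subset (φ : ℝ → ℝ) : tsupport (deriv φ) ⊆ tsupport φ :=
  closure_minimal (support_deriv_subset) isClosed_closure

/-- The derivative of a test function is again a test function, so the order-`j` relation may be
tested against `φ'`. -/
theorem IsWeakDeriv.trans {a b : ℝ} {j : ℕ} {f h g : ℝ → ℝ} (h1 : IsWeakDeriv a b j f h)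
    (h2 : IsWeakDeriv a b 1 h g) : IsWeakDeriv a b (j + 1) f g := by
  intro φ hφ hc hs
  have e1 := h1 (deriv φ) (hφ.iterate_deriv 1) hc.deriv ((tsupport_deriv_subset φ).trans hs)
  have e2 := h2 φ hφ hc hs
  rw [iteratedDeriv_one] at e2
  rw [iteratedDeriv_succ', e1, e2]
  ring

/-- Also by testing against `φ'`. It makes consecutive derivatives a function and its first weak
derivative, so that each is a primitive of the next. -/
theorem IsWeakDeriv.of_succ {a b : ℝ} {j : ℕ} {f h g : ℝ → ℝ} (h1 : IsWeakDeriv a b j f h)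
    (h2 : IsWeakDeriv a b (j + 1) f g) : IsWeakDeriv a b 1 h g := by
  intro φ hφ hc hs
  have e1 := h1 (deriv φ) (hφ.iterate_deriv 1) hc.deriv ((tsupport_deriv_subset φ).trans hs)
  have e2 := h2 φ hφ hc hs
  rw [iteratedDeriv_succ', e1] at e2
  rw [iteratedDeriv_one]
  have h3 : ((-1 : ℝ) ^ j) * (-1) ^ j = 1 := by rw [← mul_pow]; simp
  linear_combination (-1 : ℝ) ^ j * e2 - (∫ s in a..b, h s * deriv φ s) * h3
    - (∫ s in a..b, g s * φ s) * h3

theorem integrable_mul_test {a b : ℝ} {f φ : ℝ → ℝ} (hf : Integrable f (vol a b))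
    (hφ : Continuous φ) : Integrable (fun s => f s * φ s) (vol a b) := by
  have := (memLp_one_iff_integrable.2 hf).mul (r := 1) (memLp_top_of_continuous a b hφ)
  rw [mul_comm] at this
  exact memLp_one_iff_integrable.1 this

/-- The fundamental lemma of the calculus of variations on `(a,b)`. -/
theorem ae_eq_zero_of_forall_test {a b : ℝ} (hab : a ≤ b) {f : ℝ → ℝ}
    (hf : Integrable f (vol a b))
    (h : ∀ φ : ℝ → ℝ, ContDiff ℝ ∞ φ → HasCompactSupport φ → tsupport φ ⊆ Set.Ioo a b →
      ∫ s in a..b, f s * φ s = 0) : f =ᵐ[vol a b] 0 := by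
  have hz : ∀ φ : ℝ → ℝ, tsupport φ ⊆ Set.Ioo a b →
      ∫ s, φ s • f s = ∫ s in a..b, f s * φ s := by
    intro φ hs
    rw [integral_eq_vol hab, setIntegral_eq_integral_of_forall_compl_eq_zero]
    · simp [mul_comm]
    · intro s hs'
      rw [image_eq_zero_of_notMem_tsupport fun h' => hs' (Set.Ioo_subset_Icc_self (hs h')),
        mul_zero]
  have := isOpen_Ioo.ae_eq_zero_of_integral_contDiff_smul_eq_zero (μ := volume) (f := f)
    (U := Set.Ioo a b)
    (IntegrableOn.locallyIntegrableOn (IntegrableOn.mono_set hf Set.Ioo_subset_Icc_self))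
    fun φ h1 h2 h3 => by rw [hz φ h3, h φ h1 h2 h3]
  rw [vol, ← restrict_Ioo_eq_restrict_Icc]
  exact (ae_restrict_iff' measurableSet_Ioo).2 this

theorem IsWeakDeriv.unique {a b : ℝ} (hab : a ≤ b) {k : ℕ} {f g g' : ℝ → ℝ}
    (hg : Integrable g (vol a b)) (hg' : Integrable g' (vol a b))
    (h : IsWeakDeriv a b k f g) (h' : IsWeakDeriv a b k f g') : g =ᵐ[vol a b] g' := by
  have := ae_eq_zero_of_forall_test hab (hg.sub hg') fun φ h1 h2 h3 => by
    have e := (h φ h1 h2 h3).symm.trans (h' φ h1 h2 h3)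
    have hm : a ∈ Set.Icc a b := ⟨le_rfl, hab⟩
    have hm' : b ∈ Set.Icc a b := ⟨hab, le_rfl⟩
    have hi := intervalIntegrable_of_vol (integrable_mul_test hg h1.continuous) hm hm'
    have hi' := intervalIntegrable_of_vol (integrable_mul_test hg' h1.continuous) hm hm'
    simp only [Pi.sub_apply, sub_mul]
    rw [intervalIntegral.integral_sub hi hi', sub_eq_zero]
    exact mul_left_cancel₀ (pow_ne_zero _ (by norm_num)) e
  filter_upwards [this] with s hs
  simpa [sub_eq_zero] using hs

theorem test_eq_zero_right {a b : ℝ} {φ : ℝ → ℝ} (hs : tsupport φ ⊆ Set.Ioo a b) : φ b = 0 :=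
  image_eq_zero_of_notMem_tsupport fun h => lt_irrefl _ (hs h).2

theorem test_eq_zero_left {a b : ℝ} {φ : ℝ → ℝ} (hs : tsupport φ ⊆ Set.Ioo a b) : φ a = 0 :=
  image_eq_zero_of_notMem_tsupport fun h => lt_irrefl _ (hs h).1

/-- Integration by parts obtained from Fubini: `∫ φ'(s) ∫_a^s u = ∫ u(η) ∫_η^b φ'`, and the inner
integral is `-φ(η)`. The constant drops out because `∫_a^b φ' = -φ(a) = 0`. -/
theorem isWeakDeriv_primitive {a b : ℝ} (hab : a ≤ b) {u : ℝ → ℝ} (hu : Integrable u (vol a b))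
    (c : ℝ) : IsWeakDeriv a b 1 (fun s => c + ∫ η in a..s, u η) u := by
  intro φ hφ hc hs
  have hd : Continuous (deriv φ) := hφ.continuous_deriv (by simp)
  have hdi : Integrable (deriv φ) (vol a b) := (hd.integrableOn_Icc)
  have hF := integral_mul_volterra hab (κ := fun _ => 1) continuous_const hdi hu
  have hftc : ∀ η, ∫ θ in η..b, deriv φ θ = - φ η := fun η => by
    rw [intervalIntegral.integral_deriv_eq_sub
      (fun x _ => (hφ.differentiable (by simp)).differentiableAt)
      (hd.intervalIntegrable _ _), test_eq_zero_right hs, zero_sub]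
  simp only [mul_one, one_mul, hftc] at hF
  have hp : Integrable (fun s => ∫ η in a..s, u η) (vol a b) :=
    (continuousOn_primitive_vol hu).integrableOn_Icc
  have hm : a ∈ Set.Icc a b := ⟨le_rfl, hab⟩
  have hm' : b ∈ Set.Icc a b := ⟨hab, le_rfl⟩
  have hi := intervalIntegrable_of_vol (integrable_mul_test hp hd) hm hm'
  simp only [iteratedDeriv_one, add_mul]
  rw [intervalIntegral.integral_add ((hd.const_mul c).intervalIntegrable _ _) hi,
    intervalIntegral.integral_const_mul, hftc, test_eq_zero_left hs]
  simp only [mul_comm _ (deriv φ _), hF, mul_comm (u _)]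
  simp [intervalIntegral.integral_neg]

/-- Du Bois-Reymond's lemma. -/
theorem exists_ae_eq_const {a b : ℝ} (hab : a < b) {f : ℝ → ℝ} (hf : Integrable f (vol a b))
    (h : IsWeakDeriv a b 1 f 0) : ∃ c, f =ᵐ[vol a b] fun _ => c := by
  let m := (a + b) / 2
  -- The outer radius, a quarter of the length about the midpoint, keeps the support inside `(a,b)`.
  let β : ContDiffBump m := ⟨(b - a) / 8, (b - a) / 4, by linarith, by linarith⟩
  have hβs : tsupport β ⊆ Set.Ioo a b := by
    rw [β.tsupport_eq, Real.closedBall_eq_Icc]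
    intro s hs
    have h1 := hs.1
    have h2 := hs.2
    simp only [m, β] at h1 h2
    constructor <;> linarith
  set I := ∫ s in a..b, β s with hI
  have hIpos : 0 < I := by
    have : I = ∫ s, β s := by
      rw [hI, integral_eq_vol hab.le, setIntegral_eq_integral_of_forall_compl_eq_zero]
      intro s hs'
      exact image_eq_zero_of_notMem_tsupport fun h' => hs' (Set.Ioo_subset_Icc_self (hβs h'))
    rw [this]; exact β.integral_pos
  have hm : a ∈ Set.Icc a b := ⟨le_rfl, hab.le⟩
  have hm' : b ∈ Set.Icc a b := ⟨hab.le, le_rfl⟩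
  have hβc : ContDiff ℝ ∞ β := β.contDiff
  refine ⟨(∫ s in a..b, f s * β s) / I, ?_⟩
  have := ae_eq_zero_of_forall_test hab.le (hf.sub (integrable_const
      ((∫ s in a..b, f s * β s) / I))) fun ψ h1 h2 h3 => by
    set J := ∫ s in a..b, ψ s with hJ
    -- Subtracting a multiple of the bump makes the mean zero, so the primitive `Φ` of `χ` is itself
    -- a test function.
    let χ : ℝ → ℝ := fun s => ψ s - J / I * β s
    have hχ : ContDiff ℝ ∞ χ := h1.sub (contDiff_const.mul hβc)
    have hχs : Function.support χ ⊆ tsupport ψ ∪ tsupport β := by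
      intro s hs
      by_contra hn
      rw [Set.mem_union, not_or] at hn
      apply hs
      simp only [χ, image_eq_zero_of_notMem_tsupport hn.1,
        image_eq_zero_of_notMem_tsupport hn.2, mul_zero, sub_zero]
    have hcl : IsCompact (tsupport ψ ∪ tsupport β) := h2.isCompact.union β.hasCompactSupport
    have hsub : tsupport ψ ∪ tsupport β ⊆ Set.Ioo a b := Set.union_subset h3 hβs
    have hχ0 : ∫ s in a..b, χ s = 0 := by
      simp only [χ]
      rw [intervalIntegral.integral_sub (h1.continuous.intervalIntegrable _ _)
        ((hβc.continuous.intervalIntegrable _ _).const_mul _),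
        intervalIntegral.integral_const_mul, ← hI, ← hJ]
      field_simp; simp
    let Φ : ℝ → ℝ := fun s => ∫ t in a..s, χ t
    have hΦd : ∀ s, HasDerivAt Φ (χ s) s := fun s =>
      intervalIntegral.integral_hasDerivAt_right (hχ.continuous.intervalIntegrable _ _)
        (hχ.continuous.stronglyMeasurableAtFilter _ _) hχ.continuous.continuousAt
    have hderiv : deriv Φ = χ := funext fun s => (hΦd s).deriv
    have hΦ : ContDiff ℝ ∞ Φ := by
      rw [contDiff_infty_iff_deriv]
      exact ⟨fun s => (hΦd s).differentiableAt, hderiv ▸ hχ⟩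
    obtain ⟨l, hl1, hl2⟩ : ∃ l, a < l ∧ ∀ s ∈ tsupport ψ ∪ tsupport β, l ≤ s := by
      rcases (tsupport ψ ∪ tsupport β).eq_empty_or_nonempty with he | hne
      · exact ⟨b, hab, by simp [he]⟩
      · obtain ⟨l, hl, hlm⟩ := hcl.exists_isLeast hne
        exact ⟨l, (hsub hl).1, fun s hs => hlm hs⟩
    obtain ⟨r, hr1, hr2⟩ : ∃ r, r < b ∧ ∀ s ∈ tsupport ψ ∪ tsupport β, s ≤ r := by
      rcases (tsupport ψ ∪ tsupport β).eq_empty_or_nonempty with he | hne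
      · exact ⟨a, hab, by simp [he]⟩
      · obtain ⟨l, hl, hlm⟩ := hcl.exists_isGreatest hne
        exact ⟨l, (hsub hl).2, fun s hs => hlm hs⟩
    have hχz : ∀ s, s ∉ Set.Icc l r → χ s = 0 := fun s hs => by
      by_contra hn
      exact hs ⟨hl2 s (hχs hn), hr2 s (hχs hn)⟩
    -- Left of `l` nothing has been integrated yet; right of `r` the whole mean of `χ` has been, and
    -- it is zero.
    have hΦz : ∀ s, s ∉ Set.Icc l r → Φ s = 0 := fun s hs => by
      rw [Set.mem_Icc, not_and_or, not_le, not_le] at hs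
      rcases hs with hs | hs
      · refine (intervalIntegral.integral_congr fun t ht => ?_).trans
          intervalIntegral.integral_zero
        refine hχz t fun ht' => ?_
        have := ht.2
        have h5 := ht'.1
        rcases le_max_iff.1 this with h6 | h6 <;> linarith
      · have : Φ s = (∫ t in a..b, χ t) + ∫ t in b..s, χ t :=
          (intervalIntegral.integral_add_adjacent_intervals
            (hχ.continuous.intervalIntegrable _ _) (hχ.continuous.intervalIntegrable _ _)).symm
        rw [this, hχ0, zero_add]
        refine (intervalIntegral.integral_congr fun t ht => ?_).trans
          intervalIntegral.integral_zero
        refine hχz t fun ht' => ?_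
        have := ht.1
        have h5 := ht'.2
        rcases min_le_iff.1 this with h6 | h6 <;> linarith
    have hΦs : tsupport Φ ⊆ Set.Icc l r := closure_minimal
      (fun s hs => by by_contra hn; exact hs (hΦz s hn)) isClosed_Icc
    -- Testing against `Φ` gives `∫ f χ = 0`, which is `∫ (f - c) ψ = 0` with `c = (∫ f β) / I`.
    have key := h Φ hΦ (HasCompactSupport.of_support_subset_isCompact isCompact_Icc
      (subset_closure.trans hΦs)) (hΦs.trans (Set.Icc_subset_Ioo hl1 hr1))
    simp only [iteratedDeriv_one, hderiv, Pi.zero_apply, zero_mul,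
      intervalIntegral.integral_zero, mul_zero, χ, mul_sub] at key
    have hi1 := intervalIntegrable_of_vol (integrable_mul_test hf h1.continuous) hm hm'
    have hi2 := intervalIntegrable_of_vol (integrable_mul_test hf hβc.continuous) hm hm'
    have e2 : ∀ s, f s * (J / I * β s) = J / I * (f s * β s) := fun s => by ring
    simp only [e2] at key
    rw [intervalIntegral.integral_sub hi1 (hi2.const_mul _),
      intervalIntegral.integral_const_mul] at key
    simp only [Pi.sub_apply, sub_mul]
    rw [intervalIntegral.integral_sub hi1 ((h1.continuous.intervalIntegrable _ _).const_mul _),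
      intervalIntegral.integral_const_mul, ← hJ]
    rw [← key]; ring
  filter_upwards [this] with s hs
  simpa [sub_eq_zero] using hs

/-- The difference of `f` and the primitive of `g` has weak derivative zero, so it is constant by du
Bois-Reymond. -/
theorem IsWeakDeriv.exists_ae_eq_primitive {a b : ℝ} (hab : a < b) {f g : ℝ → ℝ}
    (hf : Integrable f (vol a b)) (hg : Integrable g (vol a b)) (h : IsWeakDeriv a b 1 f g) :
    ∃ c, f =ᵐ[vol a b] fun s => c + ∫ η in a..s, g η := by
  have hm : a ∈ Set.Icc a b := ⟨le_rfl, hab.le⟩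
  have hm' : b ∈ Set.Icc a b := ⟨hab.le, le_rfl⟩
  have hp : Integrable (fun s => ∫ η in a..s, g η) (vol a b) :=
    (continuousOn_primitive_vol hg).integrableOn_Icc
  obtain ⟨c, hc⟩ := exists_ae_eq_const hab (hf.sub hp) fun φ h1 h2 h3 => by
    have e1 := h φ h1 h2 h3
    have e2 := isWeakDeriv_primitive hab.le hg 0 φ h1 h2 h3
    have hd : Continuous (iteratedDeriv 1 φ) := by
      rw [iteratedDeriv_one]; exact h1.continuous_deriv (by simp)
    have hi1 := intervalIntegrable_of_vol (integrable_mul_test hf hd) hm hm'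
    have hi2 := intervalIntegrable_of_vol (integrable_mul_test hp hd) hm hm'
    simp only [zero_add] at e2
    simp only [Pi.sub_apply, sub_mul]
    rw [intervalIntegral.integral_sub hi1 hi2, e1, e2]
    simp
  refine ⟨c, ?_⟩
  filter_upwards [hc] with s hs
  simp only [Pi.sub_apply] at hs
  linarith

/-! ### Chosen weak derivatives, continuous representatives and signals. -/

theorem memLp_one_of_two {a b : ℝ} {f : ℝ → ℝ} (hf : MemLp f 2 (vol a b)) :
    Integrable f (vol a b) := hf.integrable (by norm_num)

theorem weakDeriv_spec {a b : ℝ} {k : ℕ} {f : ℝ → ℝ} (h : MemW a b k f) {j : ℕ} (hj : j ≤ k) :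
    IsWeakDeriv a b j f (weakDeriv a b j f) := by
  have := h.2 j hj
  rw [weakDeriv, dif_pos this]
  exact this.choose_spec.2

theorem weakDeriv_ae_eq {a b : ℝ} (hab : a ≤ b) {k : ℕ} {f g : ℝ → ℝ}
    (hg : MemLp g 2 (vol a b)) (h : IsWeakDeriv a b k f g) :
    weakDeriv a b k f =ᵐ[vol a b] g := by
  have h' : ∃ g, MemLp g 2 (vol a b) ∧ IsWeakDeriv a b k f g := ⟨g, hg, h⟩
  refine IsWeakDeriv.unique hab (memLp_one_of_two (memLp_weakDeriv a b k f))
    (memLp_one_of_two hg) ?_ h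
  rw [weakDeriv, dif_pos h']
  exact h'.choose_spec.2

theorem eqOn_Icc_of_ae_eq {a b : ℝ} (hab : a < b) {f g : ℝ → ℝ}
    (hf : ContinuousOn f (Set.Icc a b)) (hg : ContinuousOn g (Set.Icc a b))
    (h : f =ᵐ[vol a b] g) : Set.EqOn f g (Set.Icc a b) :=
  Measure.eqOn_Icc_of_ae_eq volume hab.ne h hf hg

theorem contRep_eqOn {a b : ℝ} (hab : a < b) {f g : ℝ → ℝ} (hg : ContinuousOn g (Set.Icc a b))
    (h : f =ᵐ[vol a b] g) : Set.EqOn (contRep a b f) g (Set.Icc a b) := by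
  have h' : ∃ g : ℝ → ℝ, ContinuousOn g (Set.Icc a b) ∧ f =ᵐ[vol a b] g := ⟨g, hg, h⟩
  rw [contRep, dif_pos h']
  exact eqOn_Icc_of_ae_eq hab h'.choose_spec.1 hg (h'.choose_spec.2.symm.trans h)

/-- A continuous function whose restrictions are in `W_1` is differentiable almost everywhere. -/
theorem ae_differentiable_of_memW1e {ι : Type} [Fintype ι] {f : ℝ → ι → ℝ} (hf : MemW1e f) :
    ∀ᵐ t ∂(volume.restrict (Set.Ici (0 : ℝ))), DifferentiableAt ℝ f t := by
  have h1 : ∀ T : ℕ, ∀ i, ∀ᵐ t, t ∈ Set.Ioo (0 : ℝ) (T + 1) →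
      DifferentiableAt ℝ (fun t => f t i) t := by
    intro T i
    have hT : (0 : ℝ) < T + 1 := by positivity
    have hW := hf.2 (T + 1) hT i
    have hd := weakDeriv_spec hW le_rfl
    set g := weakDeriv 0 ((T : ℝ) + 1) 1 (fun t => f t i)
    have hg : Integrable g (vol 0 ((T : ℝ) + 1)) := memLp_one_of_two (memLp_weakDeriv _ _ _ _)
    obtain ⟨c, hc⟩ := hd.exists_ae_eq_primitive hT (memLp_one_of_two hW.1) hg
    have hcont : ContinuousOn (fun t => f t i) (Set.Icc 0 ((T : ℝ) + 1)) :=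
      ((continuous_apply i).comp_continuousOn hf.1).mono Set.Icc_subset_Ici_self
    -- Continuity upgrades the almost-everywhere identity to every point, as differentiability at a
    -- point requires. Lebesgue differentiation of the primitive then applies.
    have heq := eqOn_Icc_of_ae_eq hT hcont
      (continuousOn_const.add (continuousOn_primitive_vol hg)) hc
    have hm : (0 : ℝ) ∈ Set.Icc 0 ((T : ℝ) + 1) := ⟨le_rfl, hT.le⟩
    have hm' : (T : ℝ) + 1 ∈ Set.Icc 0 ((T : ℝ) + 1) := ⟨hT.le, le_rfl⟩
    filter_upwards [(intervalIntegrable_of_vol hg hm hm').ae_hasDerivAt_integral] with t ht htm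
    have htm' : t ∈ Set.Icc 0 ((T : ℝ) + 1) := Set.Ioo_subset_Icc_self htm
    have h5 := ((ht (by rwa [Set.uIcc_of_le hT.le]) 0
      (by rwa [Set.uIcc_of_le hT.le])).const_add c).differentiableAt
    refine h5.congr_of_eventuallyEq ?_
    filter_upwards [isOpen_Ioo.mem_nhds htm] with t' ht'
    exact heq (Set.Ioo_subset_Icc_self ht')
  have h2 : ∀ᵐ t, ∀ T : ℕ, ∀ i, t ∈ Set.Ioo (0 : ℝ) (T + 1) →
      DifferentiableAt ℝ (fun t => f t i) t :=
    ae_all_iff.2 fun T => ae_all_iff.2 fun i => h1 T i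
  -- The null point `0` is discarded, since the derivative is two-sided.
  rw [← restrict_Ioi_eq_restrict_Ici]
  filter_upwards [ae_restrict_of_ae h2, ae_restrict_mem measurableSet_Ioi] with t ht hpos
  obtain ⟨T, hT⟩ := exists_nat_gt t
  exact differentiableAt_pi.2 fun i => ht T i ⟨hpos, by linarith⟩

theorem MemW1e.mulVec {ι κ : Type} [Fintype ι] [Fintype κ] {f : ℝ → ι → ℝ} (hf : MemW1e f)
    (M : Matrix κ ι ℝ) : MemW1e (fun t => M *ᵥ f t) := by
  refine ⟨?_, fun T hT i => ⟨?_, fun l hl => ?_⟩⟩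
  · refine continuousOn_pi.2 fun i => ?_
    exact continuousOn_finsetSum _ fun j _ =>
      continuousOn_const.mul ((continuous_apply j).comp_continuousOn hf.1)
  · exact memLp_finsetSum _ fun j _ => (hf.2 T hT j).1.const_mul _
  · have hW := fun j => weakDeriv_spec (hf.2 T hT j) hl
    refine ⟨fun t => ∑ j, M i j * weakDeriv 0 T l (fun t => f t j) t,
      memLp_finsetSum _ fun j _ => (memLp_weakDeriv _ _ _ _).const_mul _, ?_⟩
    intro φ h1 h2 h3
    have hm : (0 : ℝ) ∈ Set.Icc 0 T := ⟨le_rfl, hT.le⟩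
    have hm' : T ∈ Set.Icc 0 T := ⟨hT.le, le_rfl⟩
    have hc : Continuous (iteratedDeriv l φ) := h1.continuous_iteratedDeriv l (by exact_mod_cast le_top)
    simp only [Matrix.mulVec, dotProduct, Finset.sum_mul, mul_assoc]
    rw [intervalIntegral.integral_finsetSum, intervalIntegral.integral_finsetSum,
      Finset.mul_sum]
    · refine Finset.sum_congr rfl fun j _ => ?_
      rw [intervalIntegral.integral_const_mul, intervalIntegral.integral_const_mul,
        hW j φ h1 h2 h3]
      ring
    · exact fun j _ => (intervalIntegrable_of_vol (integrable_mul_test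
        (memLp_one_of_two (memLp_weakDeriv _ _ _ _)) h1.continuous) hm hm').const_mul _
    · exact fun j _ => (intervalIntegrable_of_vol (integrable_mul_test
        (memLp_one_of_two (hf.2 T hT j).1) hc) hm hm').const_mul _

/-! ## Vector- and matrix-valued functions on `[a,b]` -/

/-- Square integrability on `[a,b]` of a matrix-valued function. -/
def SqIntMat (a b : ℝ) {ι κ : Type} (M : ℝ → Matrix ι κ ℝ) : Prop :=
  ∀ i j, MemLp (fun s => M s i j) 2 (vol a b)

theorem memLp_two_of_top {a b : ℝ} {f : ℝ → ℝ} (hf : MemLp f ⊤ (vol a b)) :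
    MemLp f 2 (vol a b) := hf.mono_exponent le_top

section Mat
variable {a b : ℝ} {ι κ μ : Type}

theorem SqIntMat.add {M M' : ℝ → Matrix ι κ ℝ} (h : SqIntMat a b M) (h' : SqIntMat a b M') :
    SqIntMat a b (fun s => M s + M' s) := fun i j => (h i j).add (h' i j)

theorem SqIntMat.sub {M M' : ℝ → Matrix ι κ ℝ} (h : SqIntMat a b M) (h' : SqIntMat a b M') :
    SqIntMat a b (fun s => M s - M' s) := fun i j => (h i j).sub (h' i j)

theorem SqIntMat.mul_const [Fintype κ] {M : ℝ → Matrix ι κ ℝ} (h : SqIntMat a b M)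
    (K : Matrix κ μ ℝ) : SqIntMat a b (fun s => M s * K) := fun i j =>
  memLp_finsetSum _ fun k _ => by
    simpa only [mul_comm] using (h i k).const_mul (K k j)

theorem SqIntMat.const_mul [Fintype κ] {M : ℝ → Matrix κ μ ℝ} (h : SqIntMat a b M)
    (K : Matrix ι κ ℝ) : SqIntMat a b (fun s => K * M s) := fun i j =>
  memLp_finsetSum _ fun k _ => (h k j).const_mul (K i k)

theorem integrable_mul_of_memLp_two {f g : ℝ → ℝ} (hf : MemLp f 2 (vol a b))
    (hg : MemLp g 2 (vol a b)) : Integrable (fun s => f s * g s) (vol a b) :=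
  hf.integrable_mul hg

theorem SqIntMat.integrable_mul [Fintype κ] {M : ℝ → Matrix ι κ ℝ} {K : ℝ → Matrix κ μ ℝ}
    (h : SqIntMat a b M) (h' : SqIntMat a b K) (i j) :
    Integrable (fun s => (M s * K s) i j) (vol a b) :=
  integrable_finsetSum _ fun k _ => integrable_mul_of_memLp_two (h i k) (h' k j)

theorem SqIntMat.integrable_mulVec [Fintype κ] {M : ℝ → Matrix ι κ ℝ} {u : ℝ → κ → ℝ}
    (h : SqIntMat a b M) (h' : ∀ k, MemLp (fun s => u s k) 2 (vol a b)) (i) :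
    Integrable (fun s => (M s *ᵥ u s) i) (vol a b) :=
  integrable_finsetSum _ fun k _ => integrable_mul_of_memLp_two (h i k) (h' k)

theorem vecInt_add (hab : a ≤ b) {f g : ℝ → ι → ℝ}
    (hf : ∀ i, Integrable (fun s => f s i) (vol a b))
    (hg : ∀ i, Integrable (fun s => g s i) (vol a b)) :
    vecInt a b (fun s => f s + g s) = vecInt a b f + vecInt a b g := by
  ext i
  have hm : a ∈ Set.Icc a b := ⟨le_rfl, hab⟩
  have hm' : b ∈ Set.Icc a b := ⟨hab, le_rfl⟩
  exact intervalIntegral.integral_add (intervalIntegrable_of_vol (hf i) hm hm')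
    (intervalIntegrable_of_vol (hg i) hm hm')

theorem vecInt_congr (hab : a ≤ b) {f g : ℝ → ι → ℝ} (h : ∀ᵐ s ∂(vol a b), f s = g s) :
    vecInt a b f = vecInt a b g := by
  ext i
  exact integral_congr_vol hab (by filter_upwards [h] with s hs; rw [hs])

theorem mulVec_vecInt [Fintype κ] (hab : a ≤ b) (K : Matrix ι κ ℝ) {f : ℝ → κ → ℝ}
    (hf : ∀ i, Integrable (fun s => f s i) (vol a b)) :
    K *ᵥ vecInt a b f = vecInt a b (fun s => K *ᵥ f s) := by
  ext i
  have hm : a ∈ Set.Icc a b := ⟨le_rfl, hab⟩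
  have hm' : b ∈ Set.Icc a b := ⟨hab, le_rfl⟩
  simp only [vecInt, Matrix.mulVec, dotProduct]
  rw [intervalIntegral.integral_finsetSum fun j _ =>
    (intervalIntegrable_of_vol (hf j) hm hm').const_mul _]
  simp only [intervalIntegral.integral_const_mul]

theorem matInt_mulVec [Fintype κ] (hab : a ≤ b) {M : ℝ → Matrix ι κ ℝ}
    (hM : ∀ i j, Integrable (fun s => M s i j) (vol a b)) (w : κ → ℝ) :
    matInt a b M *ᵥ w = vecInt a b (fun s => M s *ᵥ w) := by
  ext i
  have hm : a ∈ Set.Icc a b := ⟨le_rfl, hab⟩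
  have hm' : b ∈ Set.Icc a b := ⟨hab, le_rfl⟩
  simp only [vecInt, matInt, Matrix.mulVec, dotProduct, Matrix.of_apply]
  rw [intervalIntegral.integral_finsetSum fun j _ =>
    (intervalIntegrable_of_vol (hM i j) hm hm').mul_const _]
  simp only [intervalIntegral.integral_mul_const]

theorem matInt_mul [Fintype κ] (hab : a ≤ b) {M : ℝ → Matrix ι κ ℝ}
    (hM : ∀ i j, Integrable (fun s => M s i j) (vol a b)) (K : Matrix κ μ ℝ) :
    matInt a b M * K = matInt a b (fun s => M s * K) := by
  ext i l
  have hm : a ∈ Set.Icc a b := ⟨le_rfl, hab⟩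
  have hm' : b ∈ Set.Icc a b := ⟨hab, le_rfl⟩
  simp only [matInt, Matrix.mul_apply, Matrix.of_apply]
  rw [intervalIntegral.integral_finsetSum fun j _ =>
    (intervalIntegrable_of_vol (hM i j) hm hm').mul_const _]
  simp only [intervalIntegral.integral_mul_const]

end Mat

/-! ## The state built from its highest derivatives and its boundary values -/

theorem continuous_tau (k : ℕ) : Continuous (tau k) := by
  unfold tau; fun_prop

theorem integral_tau (k : ℕ) (c s : ℝ) :
    ∫ t in c..s, tau k (t - c) = tau (k + 1) (s - c) := by
  simp only [tau]
  rw [intervalIntegral.integral_comp_sub_right (fun t => t ^ k / (k.factorial : ℝ)) c,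
    intervalIntegral.integral_div, integral_pow, Nat.factorial_succ]
  push_cast
  field_simp
  ring

section State
variable {N : ℕ} {n : Fin (N + 1) → ℕ}

/-- `∂_s^j x_p` as an entry of `F x`. -/
def CoreIdx.toDeriv (q : CoreIdx n) : DerivIdx n := ⟨(q.1.1.castSucc, q.1.2), q.2.le⟩

/-- `∂_s^{j+1} x_p` as an entry of `F x`. -/
def CoreIdx.succ (q : CoreIdx n) : DerivIdx n := ⟨(q.1.1.succ, q.1.2), q.2⟩

/-- The Taylor formula `T(s-a) c + ∫_a^s Q(s-η) u(η) dη`: the functions `C x` for the state `x`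
with highest derivatives `u` and boundary values `c` at `a`. -/
def taylor (a : ℝ) (u : ℝ → StateIdx n → ℝ) (c : CoreIdx n → ℝ) (s : ℝ) : CoreIdx n → ℝ :=
  TT n (s - a) *ᵥ c + vecInt a s (fun η => QQ n (s - η) *ᵥ u η)

/-- All derivatives `F x` for the state `x` with highest derivatives `u` and boundary
values `c` at `a`. -/
def jet (a : ℝ) (u : ℝ → StateIdx n → ℝ) (c : CoreIdx n → ℝ) (s : ℝ) : DerivIdx n → ℝ :=
  U1 n *ᵥ u s + U2 n *ᵥ taylor a u c s

theorem QQ_mulVec (s : ℝ) (w : StateIdx n → ℝ) (q : CoreIdx n) :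
    (QQ n s *ᵥ w) q = tau ((q.1.2.1 : ℕ) - 1 - (q.1.1 : ℕ)) s * w q.1.2 := by
  simp [QQ, Matrix.mulVec, dotProduct, ite_mul]

theorem taylor_apply (a : ℝ) (u : ℝ → StateIdx n → ℝ) (c : CoreIdx n → ℝ) (s : ℝ)
    (q : CoreIdx n) : taylor a u c s q = (∑ q', TT n (s - a) q q' * c q')
      + ∫ η in a..s, tau ((q.1.2.1 : ℕ) - 1 - (q.1.1 : ℕ)) (s - η) * u η q.1.2 := by
  simp only [taylor, Pi.add_apply, vecInt, QQ_mulVec]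
  rfl

/-- Each row of `F x` is fed by exactly one of `U₁` and `U₂`: by `U₂` when the order is below the
level, by `U₁` when they are equal (`jet_of_eq`). -/
theorem jet_toDeriv (a : ℝ) (u : ℝ → StateIdx n → ℝ) (c : CoreIdx n → ℝ) (s : ℝ)
    (q : CoreIdx n) : jet a u c s q.toDeriv = taylor a u c s q := by
  have h1 : (U1 n *ᵥ u s) q.toDeriv = 0 := by
    simp only [Matrix.mulVec, dotProduct]
    refine Finset.sum_eq_zero fun p _ => ?_
    rw [U1, Matrix.of_apply, if_neg, zero_mul]
    rintro ⟨rfl, h⟩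
    have h2 := q.2
    have h3 : (q.1.1 : ℕ) = (q.1.2.1 : ℕ) := congrArg Fin.val h
    omega
  have h2 : (U2 n *ᵥ taylor a u c s) q.toDeriv = taylor a u c s q := by
    simp only [Matrix.mulVec, dotProduct]
    refine (Finset.sum_eq_single q (fun q' _ hq' => ?_) (by simp)).trans ?_
    · rw [U2, Matrix.of_apply, if_neg, zero_mul]
      rintro ⟨h, h'⟩
      exact hq' (Subtype.ext (Prod.ext (Fin.ext h'.symm) h.symm))
    · rw [U2, Matrix.of_apply, if_pos ⟨rfl, rfl⟩, one_mul]
  rw [jet, Pi.add_apply, h1, h2, zero_add]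

theorem jet_of_eq (a : ℝ) (u : ℝ → StateIdx n → ℝ) (c : CoreIdx n → ℝ) (s : ℝ)
    (q : DerivIdx n) (hq : q.1.1 = q.1.2.1) : jet a u c s q = u s q.1.2 := by
  have h1 : (U1 n *ᵥ u s) q = u s q.1.2 := by
    simp only [Matrix.mulVec, dotProduct]
    refine (Finset.sum_eq_single q.1.2 (fun p _ hp => ?_) (by simp)).trans ?_
    · rw [U1, Matrix.of_apply, if_neg, zero_mul]
      exact fun h => hp h.1.symm
    · rw [U1, Matrix.of_apply, if_pos ⟨rfl, hq⟩, one_mul]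
  have h2 : (U2 n *ᵥ taylor a u c s) q = 0 := by
    simp only [Matrix.mulVec, dotProduct]
    refine Finset.sum_eq_zero fun q' _ => ?_
    rw [U2, Matrix.of_apply, if_neg, zero_mul]
    rintro ⟨h, h'⟩
    have h3 := q'.2
    have h4 : (q.1.1 : ℕ) = (q.1.2.1 : ℕ) := congrArg Fin.val hq
    rw [← h] at h3
    omega
  rw [jet, Pi.add_apply, h1, h2, add_zero]

/-- In a row of order one below the level, the only order that is at least this one and still below
the level is itself. -/
theorem TT_of_top (q : CoreIdx n) (hq : (q.1.1 : ℕ) + 1 = (q.1.2.1 : ℕ)) (s : ℝ)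
    (q' : CoreIdx n) : TT n s q q' = if q' = q then 1 else 0 := by
  rw [TT, Matrix.of_apply]
  have h' := q'.2
  by_cases hqq : q' = q
  · subst hqq
    simp [tau]
  · rw [if_neg hqq, if_neg]
    rintro ⟨h1, h2⟩
    rw [← h1] at h'
    have h3 : (q.1.1 : ℕ) ≤ (q'.1.1 : ℕ) := h2
    exact hqq (Subtype.ext (Prod.ext (Fin.ext (by omega)) h1.symm))

theorem continuous_TT (q q' : CoreIdx n) : Continuous (fun s => TT n s q q') := by
  simp only [TT, Matrix.of_apply]
  split_ifs
  · exact continuous_tau _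
  · exact continuous_const

/-- Differentiating `T` moves a row to the next order, since `τ_{k+1}' = τ_k`; the diagonal entry
`τ_0 = 1` supplies the constant of integration. -/
theorem TT_eq_integral (q r : CoreIdx n) (hp : r.1.2 = q.1.2)
    (hr : (r.1.1 : ℕ) = (q.1.1 : ℕ) + 1) (a s : ℝ) (q' : CoreIdx n) :
    TT n (s - a) q q' = (if q' = q then 1 else 0) + ∫ σ in a..s, TT n (σ - a) r q' := by
  simp only [TT, Matrix.of_apply, hp, Fin.le_def, hr]
  by_cases h1 : q.1.2 = q'.1.2
  · simp only [h1, true_and]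
    rcases lt_trichotomy (q.1.1 : ℕ) (q'.1.1 : ℕ) with h | h | h
    · rw [if_pos h.le, if_neg (by rintro rfl; exact lt_irrefl _ h)]
      simp only [Nat.succ_le_of_lt h, if_true, integral_tau, zero_add]
      congr 1; omega
    · rw [if_pos h.le, if_pos (Subtype.ext (Prod.ext (Fin.ext h.symm) h1.symm))]
      simp [h, tau]
    · rw [if_neg (by omega), if_neg (by rintro rfl; exact lt_irrefl _ h)]
      simp [show ¬ (q.1.1 : ℕ) + 1 ≤ (q'.1.1 : ℕ) by omega]
  · have : q' ≠ q := by rintro rfl; exact h1 rfl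
    simp [h1, this]

theorem taylor_self (a : ℝ) (u : ℝ → StateIdx n → ℝ) (c : CoreIdx n → ℝ) :
    taylor a u c a = c := by
  ext q
  rw [taylor_apply, intervalIntegral.integral_same, add_zero, sub_self]
  refine (Finset.sum_eq_single q (fun q' _ hq' => ?_) (by simp)).trans ?_
  · rw [TT, Matrix.of_apply]
    split_ifs with h
    · have : (q.1.1 : ℕ) < (q'.1.1 : ℕ) := lt_of_le_of_ne h.2 fun h3 =>
        hq' (Subtype.ext (Prod.ext (Fin.ext h3.symm) h.1.symm))
      rw [tau, zero_pow (by omega)]; simp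
    · simp
  · simp [TT, tau]

variable {a b : ℝ}

/-- Each entry of `C x` is the primitive of the next entry of `F x`. -/
theorem taylor_eq_primitive {u : ℝ → StateIdx n → ℝ}
    (hu : ∀ p, Integrable (fun s => u s p) (vol a b)) (c : CoreIdx n → ℝ) {s : ℝ}
    (hs : s ∈ Set.Icc a b) (q : CoreIdx n) :
    taylor a u c s q = c q + ∫ σ in a..s, jet a u c σ q.succ := by
  -- At the top order the next derivative is `u` itself and the remainder kernel is `τ_0 = 1`.
  -- Otherwise the next derivative is another Taylor expression, with kernel `τ_m`.
  by_cases hq : (q.1.1 : ℕ) + 1 = (q.1.2.1 : ℕ)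
  · have h1 : ∀ σ, jet a u c σ q.succ = u σ q.1.2 := fun σ =>
      jet_of_eq a u c σ q.succ (Fin.ext hq)
    simp only [taylor_apply, h1, TT_of_top q hq, ite_mul, one_mul, zero_mul,
      Finset.sum_ite_eq', Finset.mem_univ, if_true]
    simp [← hq, tau]
  · have hlt : (q.1.1 : ℕ) + 1 < (q.1.2.1 : ℕ) := lt_of_le_of_ne q.2 hq
    let r : CoreIdx n := ⟨(⟨(q.1.1 : ℕ) + 1, by have := q.1.2.1.isLt; omega⟩, q.1.2), hlt⟩
    have hr : q.succ = r.toDeriv := rfl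
    set m := (q.1.2.1 : ℕ) - 1 - ((q.1.1 : ℕ) + 1) with hm
    have hm1 : (q.1.2.1 : ℕ) - 1 - (q.1.1 : ℕ) = m + 1 := by omega
    have husub : Integrable (fun s => u s q.1.2) (vol a s) :=
      IntegrableOn.mono_set (hu q.1.2) (Set.Icc_subset_Icc_right hs.2)
    -- With weight 1, the exchange integrates `τ_m(σ - η)` over `σ` from `η` to `s` and so produces
    -- `τ_{m+1}(s - η)`.
    have hF := integral_mul_volterra hs.1 (continuous_tau m)
      (d := fun _ => 1) (integrable_const _) husub
    simp only [one_mul, integral_tau] at hF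
    have hJ := memLp_top_volterra_left (continuous_tau m) husub
    have has : a ∈ Set.Icc a s := ⟨le_rfl, hs.1⟩
    have hss : s ∈ Set.Icc a s := ⟨hs.1, le_rfl⟩
    have hJi := intervalIntegrable_of_vol (memLp_one_of_two (memLp_two_of_top hJ)) has hss
    have hTc : ∀ q', Continuous fun σ => TT n (σ - a) r q' * c q' := fun q' =>
      ((continuous_TT r q').comp (continuous_id.sub continuous_const)).mul continuous_const
    simp only [hr, jet_toDeriv, taylor_apply]
    rw [intervalIntegral.integral_add
      ((continuous_finsetSum _ fun q' _ => hTc q').intervalIntegrable _ _) hJi,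
      intervalIntegral.integral_finsetSum fun q' _ => (hTc q').intervalIntegrable _ _]
    change _ = _ + (_ + ∫ σ in a..s, ∫ η in a..σ, tau m (σ - η) * u η q.1.2)
    rw [hF, ← add_assoc, hm1]
    congr 1
    simp only [intervalIntegral.integral_mul_const,
      TT_eq_integral q r rfl rfl a s, add_mul, Finset.sum_add_distrib, ite_mul, one_mul,
      zero_mul, Finset.sum_ite_eq', Finset.mem_univ, if_true]

theorem memLp_top_taylor {u : ℝ → StateIdx n → ℝ}
    (hu : ∀ p, Integrable (fun s => u s p) (vol a b)) (c : CoreIdx n → ℝ) (q : CoreIdx n) :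
    MemLp (fun s => taylor a u c s q) ⊤ (vol a b) := by
  simp only [taylor_apply]
  refine MemLp.add (memLp_top_of_continuous a b (continuous_finsetSum _ fun q' _ => ?_))
    (memLp_top_volterra_left (continuous_tau _) (hu _))
  exact ((continuous_TT q q').comp (continuous_id.sub continuous_const)).mul continuous_const

theorem DerivIdx.eq_toDeriv_or (q : DerivIdx n) :
    q.1.1 = q.1.2.1 ∨ ∃ q' : CoreIdx n, q = q'.toDeriv := by
  rcases eq_or_lt_of_le q.2 with h | h
  · exact Or.inl (Fin.ext h)
  · refine Or.inr ⟨⟨(⟨q.1.1, ?_⟩, q.1.2), h⟩, rfl⟩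
    have := q.1.2.1.isLt
    omega

theorem memLp_jet {u : ℝ → StateIdx n → ℝ}
    (hu : ∀ p, MemLp (fun s => u s p) 2 (vol a b)) (c : CoreIdx n → ℝ) (q : DerivIdx n) :
    MemLp (fun s => jet a u c s q) 2 (vol a b) := by
  rcases q.eq_toDeriv_or with h | ⟨q, rfl⟩
  · simpa only [jet_of_eq a u c _ q h] using hu q.1.2
  · simpa only [jet_toDeriv] using
      memLp_two_of_top (memLp_top_taylor (fun p => memLp_one_of_two (hu p)) c q)

theorem continuousOn_taylor {u : ℝ → StateIdx n → ℝ}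
    (hu : ∀ p, MemLp (fun s => u s p) 2 (vol a b)) (c : CoreIdx n → ℝ) (q : CoreIdx n) :
    ContinuousOn (fun s => taylor a u c s q) (Set.Icc a b) :=
  (continuousOn_const.add (continuousOn_primitive_vol
    (memLp_one_of_two (memLp_jet hu c q.succ)))).congr fun _ hs =>
      taylor_eq_primitive (fun p => memLp_one_of_two (hu p)) c hs q

/-! ## Integral functionals of all derivatives -/

variable {ι : Type}

/-- The matrix by which `∫_a^b C (F x) ds` depends on the boundary values at `a`. -/
def boundaryRow (a b : ℝ) (C : ℝ → Matrix ι (DerivIdx n) ℝ) : Matrix ι (CoreIdx n) ℝ :=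
  matInt a b (fun s => C s * U2 n * TT n (s - a))

/-- The kernel by which `∫_a^b C (F x) ds` depends on the highest derivatives. -/
def kernelRow (b : ℝ) (C : ℝ → Matrix ι (DerivIdx n) ℝ) (η : ℝ) : Matrix ι (StateIdx n) ℝ :=
  C η * U1 n + matInt η b (fun θ => C θ * U2 n * QQ n (θ - η))

theorem sqIntMat_TT (a b : ℝ) : SqIntMat a b (fun s => TT n (s - a)) := fun q q' =>
  memLp_two_of_top (memLp_top_of_continuous a b
    ((continuous_TT q q').comp (continuous_id.sub continuous_const)))

theorem continuous_QQ (q : CoreIdx n) (p : StateIdx n) : Continuous (fun s => QQ n s q p) := by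
  simp only [QQ, Matrix.of_apply]
  split_ifs
  · exact continuous_tau _
  · exact continuous_const

theorem sqIntMat_QQ_left (a b s : ℝ) : SqIntMat a b (fun η => QQ n (s - η)) := fun q q' =>
  memLp_two_of_top (memLp_top_of_continuous a b
    ((continuous_QQ q q').comp (continuous_const.sub continuous_id)))

theorem sqIntMat_QQ_right (a b η : ℝ) : SqIntMat a b (fun s => QQ n (s - η)) := fun q q' =>
  memLp_two_of_top (memLp_top_of_continuous a b
    ((continuous_QQ q q').comp (continuous_id.sub continuous_const)))

theorem SqIntMat.mono {κ : Type} {c d : ℝ} {M : ℝ → Matrix ι κ ℝ} (h : SqIntMat a b M)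
    (hc : a ≤ c) (hd : d ≤ b) : SqIntMat c d M := fun i j =>
  (h i j).mono_measure (Measure.restrict_mono (Set.Icc_subset_Icc hc hd) le_rfl)

/-- Column `p` of `Q` is nonzero only in rows of component `p`, which reduces the matrix integral to
scalar Volterra integrals. -/
theorem matInt_mul_QQ_apply {D : ℝ → Matrix ι (CoreIdx n) ℝ} (hD : SqIntMat a b D) {η : ℝ}
    (hη : η ∈ Set.Icc a b) (i : ι) (p : StateIdx n) :
    matInt η b (fun θ => D θ * QQ n (θ - η)) i p = ∑ q : CoreIdx n, if q.1.2 = p then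
      ∫ θ in η..b, D θ i q * tau ((q.1.2.1 : ℕ) - 1 - (q.1.1 : ℕ)) (θ - η) else 0 := by
  have hm : η ∈ Set.Icc η b := ⟨le_rfl, hη.2⟩
  have hm' : b ∈ Set.Icc η b := ⟨hη.2, le_rfl⟩
  simp only [matInt, Matrix.of_apply, Matrix.mul_apply]
  rw [intervalIntegral.integral_finsetSum fun q _ => intervalIntegrable_of_vol
    (integrable_mul_of_memLp_two (hD.mono hη.1 le_rfl i q)
      (sqIntMat_QQ_right η b η q p)) hm hm']
  refine Finset.sum_congr rfl fun q _ => ?_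
  simp only [QQ, Matrix.of_apply]
  split_ifs with h
  · subst h; rfl
  · simp

theorem sqIntMat_matInt_mul_QQ {D : ℝ → Matrix ι (CoreIdx n) ℝ} (hD : SqIntMat a b D) :
    SqIntMat a b (fun η => matInt η b (fun θ => D θ * QQ n (θ - η))) := fun i p => by
  refine (memLp_congr_ae (ae_vol_of_forall fun η hη => matInt_mul_QQ_apply hD hη i p)).2 ?_
  refine memLp_finsetSum _ fun q _ => ?_
  split_ifs
  · exact memLp_two_of_top (memLp_top_volterra_right (continuous_tau _)
      (memLp_one_of_two (hD i q)))
  · exact MemLp.zero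

theorem sqIntMat_kernelRow {C : ℝ → Matrix ι (DerivIdx n) ℝ} (hC : SqIntMat a b C) :
    SqIntMat a b (kernelRow b C) :=
  (hC.mul_const _).add (sqIntMat_matInt_mul_QQ (hC.mul_const _))

theorem memLp_volterra_QQ {u : ℝ → StateIdx n → ℝ}
    (hu : ∀ p, Integrable (fun s => u s p) (vol a b)) (q : CoreIdx n) :
    MemLp (fun s => vecInt a s (fun η => QQ n (s - η) *ᵥ u η) q) 2 (vol a b) := by
  simp only [vecInt, QQ_mulVec]
  exact memLp_two_of_top (memLp_top_volterra_left (continuous_tau _) (hu _))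

/-- Entry by entry this is `integral_mul_volterra`. Only square integrability of `D` is asked,
because `B_I` has no more. -/
theorem vecInt_mulVec_volterra (hab : a ≤ b) {D : ℝ → Matrix ι (CoreIdx n) ℝ}
    (hD : SqIntMat a b D) {u : ℝ → StateIdx n → ℝ}
    (hu : ∀ p, Integrable (fun s => u s p) (vol a b)) :
    vecInt a b (fun s => D s *ᵥ vecInt a s (fun η => QQ n (s - η) *ᵥ u η))
      = vecInt a b (fun η => matInt η b (fun θ => D θ * QQ n (θ - η)) *ᵥ u η) := by
  ext i
  have hm : a ∈ Set.Icc a b := ⟨le_rfl, hab⟩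
  have hm' : b ∈ Set.Icc a b := ⟨hab, le_rfl⟩
  have hR : ∀ η ∈ Set.Icc a b, (matInt η b (fun θ => D θ * QQ n (θ - η)) *ᵥ u η) i
      = ∑ q : CoreIdx n, (∫ θ in η..b, D θ i q
        * tau ((q.1.2.1 : ℕ) - 1 - (q.1.1 : ℕ)) (θ - η)) * u η q.1.2 := fun η hη => by
    simp only [Matrix.mulVec, dotProduct, matInt_mul_QQ_apply hD hη, Finset.sum_mul]
    rw [Finset.sum_comm]
    refine Finset.sum_congr rfl fun q _ => ?_
    simp
  have e1 : vecInt a b (fun η => matInt η b (fun θ => D θ * QQ n (θ - η)) *ᵥ u η) i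
      = ∫ η in a..b, ∑ q : CoreIdx n, (∫ θ in η..b, D θ i q
        * tau ((q.1.2.1 : ℕ) - 1 - (q.1.1 : ℕ)) (θ - η)) * u η q.1.2 :=
    integral_congr_vol hab (ae_vol_of_forall hR)
  have e2 : ∀ s q, vecInt a s (fun η => QQ n (s - η) *ᵥ u η) q
      = ∫ η in a..s, tau ((q.1.2.1 : ℕ) - 1 - (q.1.1 : ℕ)) (s - η) * u η q.1.2 := fun s q => by
    simp only [vecInt, QQ_mulVec]
  have e3 : vecInt a b (fun s => D s *ᵥ vecInt a s (fun η => QQ n (s - η) *ᵥ u η)) i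
      = ∫ s in a..b, ∑ q : CoreIdx n, D s i q
        * ∫ η in a..s, tau ((q.1.2.1 : ℕ) - 1 - (q.1.1 : ℕ)) (s - η) * u η q.1.2 := by
    simp only [← e2]; rfl
  rw [e1, e3, intervalIntegral.integral_finsetSum, intervalIntegral.integral_finsetSum]
  · exact Finset.sum_congr rfl fun q _ => integral_mul_volterra hab (continuous_tau _)
      (memLp_one_of_two (hD i q)) (hu _)
  · intro q _
    have := (hu q.1.2).mul_of_top_right (memLp_top_volterra_right
      (continuous_tau ((q.1.2.1 : ℕ) - 1 - (q.1.1 : ℕ))) (memLp_one_of_two (hD i q)))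
    exact intervalIntegrable_of_vol this hm hm'
  · intro q _
    exact intervalIntegrable_of_vol (integrable_mul_of_memLp_two (hD i q)
      (memLp_two_of_top (memLp_top_volterra_left (continuous_tau _) (hu _)))) hm hm'

/-- Integral functionals of all derivatives in terms of the boundary values at `a` and of the
highest derivatives. -/
theorem vecInt_mulVec_jet (hab : a ≤ b) {C : ℝ → Matrix ι (DerivIdx n) ℝ} (hC : SqIntMat a b C)
    {u : ℝ → StateIdx n → ℝ} (hu : ∀ p, MemLp (fun s => u s p) 2 (vol a b))
    (c : CoreIdx n → ℝ) : vecInt a b (fun s => C s *ᵥ jet a u c s)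
      = boundaryRow a b C *ᵥ c + vecInt a b (fun η => kernelRow b C η *ᵥ u η) := by
  have hu1 := fun p => memLp_one_of_two (hu p)
  have hC1 := hC.mul_const (U1 n)
  have hC2 := hC.mul_const (U2 n)
  have hT := hC2.integrable_mul (sqIntMat_TT a b)
  have hTc : ∀ i, Integrable (fun s => ((C s * U2 n * TT n (s - a)) *ᵥ c) i) (vol a b) :=
    fun i => integrable_finsetSum _ fun q _ => (hT i q).mul_const _
  have hV : ∀ i, Integrable (fun s => ((C s * U2 n) *ᵥ
      vecInt a s (fun η => QQ n (s - η) *ᵥ u η)) i) (vol a b) :=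
    hC2.integrable_mulVec (memLp_volterra_QQ hu1)
  have hTV : ∀ i, Integrable (fun s => ((C s * U2 n * TT n (s - a)) *ᵥ c
      + (C s * U2 n) *ᵥ vecInt a s (fun η => QQ n (s - η) *ᵥ u η)) i) (vol a b) :=
    fun i => (hTc i).add (hV i)
  simp only [jet, taylor, kernelRow, boundaryRow, Matrix.mulVec_add, Matrix.mulVec_mulVec,
    Matrix.add_mulVec, ← Matrix.mul_assoc]
  rw [vecInt_add hab (hC1.integrable_mulVec hu) hTV,
    vecInt_add hab hTc hV, matInt_mulVec hab hT, vecInt_mulVec_volterra hab hC2 hu1,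
    vecInt_add hab (hC1.integrable_mulVec hu)
      ((sqIntMat_matInt_mul_QQ hC2).integrable_mulVec hu)]
  abel

end State

/-! ## Elements of `L₂` and their representatives -/

section L2
variable {a b : ℝ} {ι : Type} [Fintype ι]

theorem memLp_fn (u : L2 a b ι) (i : ι) : MemLp (fun s => fn u s i) 2 (vol a b) :=
  (memLp_piLp_iff.1 (Lp.memLp u)) i

theorem fn_toL2 {f : ℝ → ι → ℝ} (hf : SqInt a b f) : ∀ᵐ s ∂(vol a b), fn (toL2 a b f) s = f s := by
  rw [toL2, dif_pos hf]
  filter_upwards [hf.memLp.coeFn_toLp] with s hs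
  ext i
  rw [fn, hs]

theorem ext_fn {u w : L2 a b ι} (h : ∀ᵐ s ∂(vol a b), fn u s = fn w s) : u = w := by
  refine Lp.ext ?_
  filter_upwards [h] with s hs
  ext i
  exact congrFun hs i

theorem sqInt_congr {f g : ℝ → ι → ℝ} (h : ∀ᵐ s ∂(vol a b), f s = g s) (hf : SqInt a b f) :
    SqInt a b g := fun i =>
  (memLp_congr_ae (by filter_upwards [h] with s hs; rw [hs])).1 (hf i)

theorem toL2_eq_of_ae {f : ℝ → ι → ℝ} {u : L2 a b ι} (h : ∀ᵐ s ∂(vol a b), fn u s = f s) :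
    toL2 a b f = u := by
  refine ext_fn ?_
  filter_upwards [h, fn_toL2 (sqInt_congr h (memLp_fn u))] with s h1 h2
  rw [h1, h2]

theorem fn_add (u w : L2 a b ι) : ∀ᵐ s ∂(vol a b), fn (u + w) s = fn u s + fn w s := by
  filter_upwards [Lp.coeFn_add u w] with s hs
  ext i
  rw [fn, hs]; rfl

theorem fn_sub (u w : L2 a b ι) : ∀ᵐ s ∂(vol a b), fn (u - w) s = fn u s - fn w s := by
  filter_upwards [Lp.coeFn_sub u w] with s hs
  ext i
  rw [fn, hs]; rfl

theorem fn_smul (c : ℝ) (u : L2 a b ι) : ∀ᵐ s ∂(vol a b), fn (c • u) s = c • fn u s := by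
  filter_upwards [Lp.coeFn_smul c u] with s hs
  ext i
  rw [fn, hs]; rfl

theorem SqInt.add {f g : ℝ → ι → ℝ} (hf : SqInt a b f) (hg : SqInt a b g) :
    SqInt a b (fun s => f s + g s) := fun i => (hf i).add (hg i)

theorem toL2_add {f g : ℝ → ι → ℝ} (hf : SqInt a b f) (hg : SqInt a b g) :
    toL2 a b (fun s => f s + g s) = toL2 a b f + toL2 a b g := by
  refine toL2_eq_of_ae ?_
  filter_upwards [fn_add (toL2 a b f) (toL2 a b g), fn_toL2 hf, fn_toL2 hg] with s h1 h2 h3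
  rw [h1, h2, h3]

theorem toL2_smul {f : ℝ → ι → ℝ} (c : ℝ) (hf : SqInt a b f) :
    toL2 a b (fun s => c • f s) = c • toL2 a b f := by
  refine toL2_eq_of_ae ?_
  filter_upwards [fn_smul c (toL2 a b f), fn_toL2 hf] with s h1 h2
  rw [h1, h2]

end L2

/-! ### States as Taylor expansions. -/

section Jets
variable {N : ℕ} {n : Fin (N + 1) → ℕ} {a b : ℝ}

/-- `x_p` as an entry of `F x`. -/
def StateIdx.toDeriv (p : StateIdx n) : DerivIdx n := ⟨(0, p), Nat.zero_le _⟩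

/-- The state with highest derivatives `u` and boundary values `c` at `a`. -/
def jetState (a : ℝ) (u : ℝ → StateIdx n → ℝ) (c : CoreIdx n → ℝ) (s : ℝ) : StateIdx n → ℝ :=
  fun p => jet a u c s (StateIdx.toDeriv p)

/-- Induction on the order: each entry is almost everywhere a primitive of the next, and weak
derivatives compose. -/
theorem isWeakDeriv_jet (hab : a ≤ b) {x u : L2 a b (StateIdx n)} {c : CoreIdx n → ℝ}
    (h : ∀ᵐ s ∂(vol a b), fn x s = jetState a (fn u) c s) (p : StateIdx n) :
    ∀ (j : ℕ) (hj : j ≤ (p.1 : ℕ)), IsWeakDeriv a b j (fun s => fn x s p)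
      (fun s => jet a (fn u) c s
        ⟨(⟨j, lt_of_le_of_lt hj p.1.isLt⟩, p), hj⟩) := by
  intro j
  induction j with
  | zero =>
    intro hj
    refine isWeakDeriv_congr hab (EventuallyEq.refl _ _) ?_ (isWeakDeriv_zero a b _)
    filter_upwards [h] with s hs
    rw [hs]; rfl
  | succ j ih =>
    intro hj
    have hjp := p.1.isLt
    let q : CoreIdx n := ⟨(⟨j, by omega⟩, p), hj⟩
    have hi := memLp_one_of_two (memLp_jet (memLp_fn u) c q.succ)
    refine (ih (Nat.le_of_succ_le hj)).trans ?_
    refine isWeakDeriv_congr hab ?_ (EventuallyEq.refl _ _) (isWeakDeriv_primitive hab hi (c q))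
    refine ae_vol_of_forall fun s hs => ?_
    change _ = jet a (fn u) c s q.toDeriv
    rw [jet_toDeriv, taylor_eq_primitive (fun p => memLp_one_of_two (memLp_fn u p)) c hs q]

theorem mem_Wn_of_jet (hab : a ≤ b) {x u : L2 a b (StateIdx n)} {c : CoreIdx n → ℝ}
    (h : ∀ᵐ s ∂(vol a b), fn x s = jetState a (fn u) c s) : x ∈ Wn n a b := fun p =>
  ⟨memLp_fn x p, fun l hl => ⟨_, memLp_jet (memLp_fn u) c _, isWeakDeriv_jet hab h p l hl⟩⟩

theorem weakDeriv_eq_jet (hab : a ≤ b) {x u : L2 a b (StateIdx n)} {c : CoreIdx n → ℝ}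
    (h : ∀ᵐ s ∂(vol a b), fn x s = jetState a (fn u) c s) (q : DerivIdx n) :
    weakDeriv a b (q.1.1 : ℕ) (fun s' => fn x s' q.1.2) =ᵐ[vol a b]
      fun s => jet a (fn u) c s q :=
  weakDeriv_ae_eq hab (memLp_jet (memLp_fn u) c q) (isWeakDeriv_jet hab h q.1.2 _ q.2)

theorem FF_eq_jet (hab : a ≤ b) {x u : L2 a b (StateIdx n)} {c : CoreIdx n → ℝ}
    (h : ∀ᵐ s ∂(vol a b), fn x s = jetState a (fn u) c s) :
    ∀ᵐ s ∂(vol a b), FF x s = jet a (fn u) c s := by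
  filter_upwards [ae_all_iff.2 fun q => weakDeriv_eq_jet hab h q] with s hs
  exact funext hs

theorem CC_eq_taylor (hab : a < b) {x u : L2 a b (StateIdx n)} {c : CoreIdx n → ℝ}
    (h : ∀ᵐ s ∂(vol a b), fn x s = jetState a (fn u) c s) {s : ℝ} (hs : s ∈ Set.Icc a b) :
    CC x s = taylor a (fn u) c s := by
  ext q
  refine contRep_eqOn hab (continuousOn_taylor (memLp_fn u) c q) ?_ hs
  filter_upwards [weakDeriv_eq_jet hab.le h q.toDeriv] with s hs
  rw [jet_toDeriv] at hs
  exact hs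

theorem TT_zero_mulVec (c : CoreIdx n → ℝ) : TT n 0 *ᵥ c = c := by
  -- With zero highest derivatives and base point `0`, the Taylor expression at the base point is
  -- `T(0) c`.
  have := taylor_self 0 (0 : ℝ → StateIdx n → ℝ) c
  rw [taylor, sub_self] at this
  rw [← this]
  conv_lhs => rw [this]
  ext q
  simp [vecInt]

/-- The kernel `[0; Q(b-η)]` by which the boundary values depend on the highest derivatives. -/
def endKernel (n : Fin (N + 1) → ℕ) (b η : ℝ) :
    Matrix (CoreIdx n ⊕ CoreIdx n) (StateIdx n) ℝ :=
  Matrix.fromRows 0 (QQ n (b - η))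

/-- The boundary values of the state with highest derivatives `u` and boundary values `c`
at `a`. -/
def boundaryValues (a b : ℝ) (u : ℝ → StateIdx n → ℝ) (c : CoreIdx n → ℝ) :
    CoreIdx n ⊕ CoreIdx n → ℝ :=
  Matrix.fromRows (TT n 0) (TT n (b - a)) *ᵥ c
    + vecInt a b (fun η => endKernel n b η *ᵥ u η)

theorem BB_eq_boundaryValues (hab : a < b) {x u : L2 a b (StateIdx n)} {c : CoreIdx n → ℝ}
    (h : ∀ᵐ s ∂(vol a b), fn x s = jetState a (fn u) c s) :
    BB x = boundaryValues a b (fn u) c := by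
  rw [BB, CC_eq_taylor hab h ⟨le_rfl, hab.le⟩, CC_eq_taylor hab h ⟨hab.le, le_rfl⟩,
    taylor_self, boundaryValues, Matrix.fromRows_mulVec, TT_zero_mulVec]
  ext (q | q)
  · simp [vecInt, endKernel, Matrix.fromRows_mulVec]
  · simp [vecInt, endKernel, Matrix.fromRows_mulVec, taylor]

/-- Every `x ∈ W^n` is determined by its highest derivatives and its boundary values at `a`. -/
theorem exists_jetState_of_mem_Wn (hab : a < b) {x : L2 a b (StateIdx n)} (hx : x ∈ Wn n a b) :
    ∃ c : CoreIdx n → ℝ, ∀ᵐ s ∂(vol a b), fn x s = jetState a (fn (DD x)) c s := by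
  let w : DerivIdx n → ℝ → ℝ := fun q => weakDeriv a b (q.1.1 : ℕ) (fun s' => fn x s' q.1.2)
  have hw : ∀ q, MemLp (w q) 2 (vol a b) := fun q => memLp_weakDeriv _ _ _ _
  have hd : ∀ q : DerivIdx n, IsWeakDeriv a b (q.1.1 : ℕ) (fun s' => fn x s' q.1.2) (w q) :=
    fun q => weakDeriv_spec (hx q.1.2) q.2
  -- The constants of integration are the required values at `a`.
  have hex : ∀ q : CoreIdx n, ∃ c : ℝ,
      w q.toDeriv =ᵐ[vol a b] fun s => c + ∫ η in a..s, w q.succ η := fun q =>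
    ((hd q.toDeriv).of_succ (hd q.succ)).exists_ae_eq_primitive hab
      (memLp_one_of_two (hw _)) (memLp_one_of_two (hw _))
  choose c hc using hex
  have hDD : ∀ᵐ s ∂(vol a b), ∀ p : StateIdx n,
      fn (DD x) s p = w ⟨(p.1, p), le_rfl⟩ s := by
    filter_upwards [fn_toL2 (a := a) (b := b)
      (f := fun s (p : StateIdx n) => weakDeriv a b (p.1 : ℕ) (fun s' => fn x s' p) s)
      fun p => memLp_weakDeriv _ _ _ _] with s hs p
    exact congrFun hs p
  -- Induction on `d`, the number of derivatives still missing: it starts from the highest ones,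
  -- which are `D x`, and integrates downwards.
  have key : ∀ d : ℕ, ∀ q : DerivIdx n, (q.1.1 : ℕ) + d = (q.1.2.1 : ℕ) →
      w q =ᵐ[vol a b] fun s => jet a (fn (DD x)) c s q := by
    intro d
    induction d with
    | zero =>
      rintro ⟨⟨j, p⟩, hjp⟩ hq
      have hj : j = p.1 := Fin.ext hq
      subst hj
      filter_upwards [hDD] with s hs
      rw [jet_of_eq _ _ _ _ _ rfl, hs p]
    | succ d ih =>
      intro q hq
      rcases q.eq_toDeriv_or with h | ⟨q, rfl⟩
      · have : (q.1.1 : ℕ) = (q.1.2.1 : ℕ) := congrArg Fin.val h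
        omega
      · have hq' : (q.1.1 : ℕ) + (d + 1) = (q.1.2.1 : ℕ) := hq
        have hs' := ih q.succ (by change (q.1.1 : ℕ) + 1 + d = (q.1.2.1 : ℕ); omega)
        filter_upwards [hc q, ae_restrict_mem measurableSet_Icc] with s h1 h2
        rw [h1, jet_toDeriv, taylor_eq_primitive
          (fun p => memLp_one_of_two (memLp_fn (DD x) p)) c h2 q,
          integral_congr_vol_left h2 hs']
  refine ⟨c, ?_⟩
  have h0 : ∀ p : StateIdx n, (fun s => fn x s p) =ᵐ[vol a b] w (StateIdx.toDeriv p) := fun p =>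
    (weakDeriv_ae_eq hab.le (memLp_fn x p) (isWeakDeriv_zero a b _)).symm
  filter_upwards [ae_all_iff.2 h0,
    ae_all_iff.2 fun p : StateIdx n => key (p.1 : ℕ) (StateIdx.toDeriv p) (zero_add _)]
    with s h1 h2
  ext p
  rw [h1 p, h2 p]; rfl

/-! ## Boundary conditions -/

theorem padFirst_mulVec {κ : Type} [Fintype κ] (M : Matrix (CoreIdx n) κ ℝ) (w : κ → ℝ)
    (p : StateIdx n) : (padFirst M *ᵥ w) p = if h : 0 < (p.1 : ℕ) then
      (M *ᵥ w) ⟨(⟨0, lt_of_lt_of_le h (Nat.lt_succ_iff.mp p.1.isLt)⟩, p), h⟩ else 0 := by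
  simp only [padFirst, Matrix.mulVec, dotProduct, Matrix.of_apply]
  split_ifs with h <;> simp

theorem sqIntMat_endKernel (a b : ℝ) : SqIntMat a b (endKernel n b) := by
  rintro (q | q) p
  · simp [endKernel]
  · exact sqIntMat_QQ_left a b b q p

variable {nBC nv : ℕ} (Gb : BCParams n nBC nv)

namespace BCParams

/-- The boundary values at `a` of the state in `X_v` with highest derivatives `u`. -/
def leftValues (a b : ℝ) (v : Fin nv → ℝ) (u : ℝ → StateIdx n → ℝ) : CoreIdx n → ℝ :=
  (Gb.BTinv a b * Gb.Bv) *ᵥ v + vecInt a b (fun η => Gb.BQ a b η *ᵥ u η)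

variable {Gb}

theorem BTinv_mul (h : Gb.Admissible a b) : Gb.BTinv a b * Gb.BT a b = 1 := by
  rw [BTinv, dif_pos h]; exact h.choose_spec.1

theorem mul_BTinv (h : Gb.Admissible a b) : Gb.BT a b * Gb.BTinv a b = 1 := by
  rw [BTinv, dif_pos h]; exact h.choose_spec.2

/-- The bracket in `B_Q` is exactly the kernel by which the boundary residual depends on the highest
derivatives. -/
theorem BQ_eq (s : ℝ) : Gb.BQ a b s = Gb.BTinv a b *
    (kernelRow b Gb.BI s - Gb.B * endKernel n b s) := rfl

theorem sqIntMat_BQ (hGb : Gb.SquareIntegrable a b) : SqIntMat a b (Gb.BQ a b) :=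
  ((sqIntMat_kernelRow hGb).sub ((sqIntMat_endKernel a b).const_mul _)).const_mul _

/-- After the Taylor substitution the residual is affine in `c`; `B_T` is minus its linear part. -/
theorem residual_eq (hab : a ≤ b) (hGb : Gb.SquareIntegrable a b) (v : Fin nv → ℝ)
    {u : ℝ → StateIdx n → ℝ} (hu : ∀ p, MemLp (fun s => u s p) 2 (vol a b))
    (c : CoreIdx n → ℝ) :
    vecInt a b (fun s => Gb.BI s *ᵥ jet a u c s) + Gb.Bv *ᵥ v
        - Gb.B *ᵥ boundaryValues a b u c
      = Gb.Bv *ᵥ v + vecInt a b (fun η =>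
        (kernelRow b Gb.BI η - Gb.B * endKernel n b η) *ᵥ u η)
        - Gb.BT a b *ᵥ c := by
  have hK : SqIntMat a b (kernelRow b Gb.BI) := sqIntMat_kernelRow hGb
  have hQ := sqIntMat_endKernel (n := n) a b
  have h1 := vecInt_add hab
    ((hK.sub (hQ.const_mul Gb.B)).integrable_mulVec hu)
    ((hQ.const_mul Gb.B).integrable_mulVec hu)
  simp only [← Matrix.add_mulVec, sub_add_cancel] at h1
  rw [vecInt_mulVec_jet hab hGb hu, boundaryValues, Matrix.mulVec_add, Matrix.mulVec_mulVec,
    mulVec_vecInt hab _ (hQ.integrable_mulVec hu), h1, BT, Matrix.sub_mulVec]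
  simp only [Matrix.mulVec_mulVec, boundaryRow]
  abel

/-- Membership in `W^n` is automatic for a jet, so only the linear system for `c` remains. Each
implication uses one of the two identities for the inverse of `B_T`. -/
theorem mem_X_iff (hab : a < b) (hGb : Gb.SquareIntegrable a b) (hadm : Gb.Admissible a b)
    {v : Fin nv → ℝ} {x u : L2 a b (StateIdx n)} {c : CoreIdx n → ℝ}
    (h : ∀ᵐ s ∂(vol a b), fn x s = jetState a (fn u) c s) :
    x ∈ Gb.X a b v ↔ c = Gb.leftValues a b v (fn u) := by
  have hK : SqIntMat a b (kernelRow b Gb.BI) := sqIntMat_kernelRow hGb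
  have hQ := sqIntMat_endKernel (n := n) a b
  have hint := (hK.sub (hQ.const_mul Gb.B)).integrable_mulVec (memLp_fn u)
  have hres : vecInt a b (fun s => Gb.BI s *ᵥ FF x s)
      = vecInt a b (fun s => Gb.BI s *ᵥ jet a (fn u) c s) :=
    vecInt_congr hab.le (by filter_upwards [FF_eq_jet hab.le h] with s hs; rw [hs])
  have hlv : Gb.leftValues a b v (fn u) = Gb.BTinv a b *ᵥ (Gb.Bv *ᵥ v + vecInt a b (fun η =>
      (kernelRow b Gb.BI η - Gb.B * endKernel n b η) *ᵥ fn u η)) := by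
    rw [Matrix.mulVec_add, mulVec_vecInt hab.le _ hint, leftValues]
    simp only [Matrix.mulVec_mulVec, BQ_eq]
  rw [X, Set.mem_ofPred_eq, and_iff_right (mem_Wn_of_jet hab.le h), hres,
    BB_eq_boundaryValues hab h, residual_eq hab.le hGb v (memLp_fn u), sub_eq_zero, hlv]
  constructor
  · intro e
    rw [e, Matrix.mulVec_mulVec, BTinv_mul hadm, Matrix.one_mulVec]
  · intro e
    rw [e, Matrix.mulVec_mulVec, mul_BTinv hadm, Matrix.one_mulVec]

theorem vecInt_add_adjacent {ι : Type} {f : ℝ → ι → ℝ}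
    (hf : ∀ i, Integrable (fun s => f s i) (vol a b)) {s : ℝ} (hs : s ∈ Set.Icc a b) :
    vecInt a s f + vecInt s b f = vecInt a b f := by
  ext i
  have hab := hs.1.trans hs.2
  exact intervalIntegral.integral_add_adjacent_intervals
    (intervalIntegrable_of_vol (hf i) ⟨le_rfl, hab⟩ hs)
    (intervalIntegrable_of_vol (hf i) hs ⟨hab, le_rfl⟩)

/-- `T̂ u + T_v v` is the state in `X_v` with highest derivatives `u`. -/
theorem That_apply_add_Gv (hGb : Gb.SquareIntegrable a b) (v : Fin nv → ℝ)
    {u : ℝ → StateIdx n → ℝ} (hu : ∀ p, MemLp (fun s => u s p) 2 (vol a b)) {s : ℝ}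
    (hs : s ∈ Set.Icc a b) :
    (Gb.That a b).apply a b u s + Gb.Gv a b s *ᵥ v
      = jetState a u (Gb.leftValues a b v u) s := by
  have hab := hs.1.trans hs.2
  have hBQ : ∀ i, Integrable (fun θ => ((TT n (s - a) * Gb.BQ a b θ) *ᵥ u θ) i) (vol a b) :=
    ((sqIntMat_BQ hGb).const_mul _).integrable_mulVec hu
  have hQ := (sqIntMat_QQ_left (n := n) a b s).integrable_mulVec hu
  ext p
  simp only [ThreePI.apply, That, Gv, Pi.add_apply, vecInt, Matrix.add_mulVec, padFirst_mulVec,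
    Matrix.mulVec_diagonal]
  -- A level-0 component is its own highest derivative and carries no boundary values.
  by_cases hp : (p.1 : ℕ) = 0
  · have e : (0 : Fin (N + 1)) = p.1 := (Fin.ext hp).symm
    simp only [hp, lt_irrefl, dif_neg, not_false_eq_true, if_true, jetState]
    rw [jet_of_eq _ _ _ _ _ (by exact e)]
    simp [StateIdx.toDeriv]
  · have hpos : 0 < (p.1 : ℕ) := Nat.pos_of_ne_zero hp
    set q : CoreIdx n := ⟨(⟨0, lt_of_lt_of_le hpos (Nat.lt_succ_iff.mp p.1.isLt)⟩, p), hpos⟩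
      with hq
    have hqd : StateIdx.toDeriv p = q.toDeriv := rfl
    simp only [hp, hpos, dif_pos, if_false, zero_mul, zero_add, jetState, hqd, jet_toDeriv,
      taylor, leftValues, ← hq]
    have hm : a ∈ Set.Icc a b := ⟨le_rfl, hab⟩
    -- `G₁` and `G₂` share the term `T₁(s-a) B_Q`, so its two integrals join into one over `[a,b]`.
    have hB := congrFun (vecInt_add_adjacent hBQ hs) q
    rw [intervalIntegral.integral_add (intervalIntegrable_of_vol (hQ q) hm hs)
      (intervalIntegrable_of_vol (hBQ q) hm hs), Matrix.mulVec_add,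
      mulVec_vecInt hab _ ((sqIntMat_BQ hGb).integrable_mulVec hu)]
    simp only [Pi.add_apply, Matrix.mulVec_mulVec, Matrix.mul_assoc] at hB ⊢
    simp only [vecInt] at hB ⊢
    linarith

theorem fn_PIEtoPDE (hGb : Gb.SquareIntegrable a b) (v : Fin nv → ℝ)
    (u : L2 a b (StateIdx n)) : ∀ᵐ s ∂(vol a b), fn (PIEtoPDE a b Gb v u) s
      = jetState a (fn u) (Gb.leftValues a b v (fn u)) s := by
  have h : ∀ᵐ s ∂(vol a b), (Gb.That a b).apply a b (fn u) s + Gb.Gv a b s *ᵥ v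
      = jetState a (fn u) (Gb.leftValues a b v (fn u)) s :=
    ae_vol_of_forall fun s hs => That_apply_add_Gv hGb v (memLp_fn u) hs
  -- Without square integrability `toL2` would return its default value `0`.
  have h1 : SqInt a b fun s => (Gb.That a b).apply a b (fn u) s + Gb.Gv a b s *ᵥ v :=
    sqInt_congr (h.mono fun s hs => hs.symm) fun p => memLp_jet (memLp_fn u) _ _
  filter_upwards [fn_toL2 h1, h] with s h2 h3
  rw [PIEtoPDE, h2, h3]

theorem sqInt_Gv (v : Fin nv → ℝ) : SqInt a b (fun s => Gb.Gv a b s *ᵥ v) := by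
  intro p
  refine memLp_two_of_top (memLp_top_of_continuous a b ?_)
  simp only [Gv, padFirst_mulVec, Matrix.mul_assoc, ← Matrix.mulVec_mulVec]
  split_ifs
  · exact continuous_finsetSum _ fun q' _ =>
      ((continuous_TT _ q').comp (continuous_id.sub continuous_const)).mul continuous_const
  · exact continuous_const

theorem sqInt_That (hGb : Gb.SquareIntegrable a b) (u : L2 a b (StateIdx n)) :
    SqInt a b ((Gb.That a b).apply a b (fn u)) :=
  -- Taking zero input isolates `T̂ u`.
  sqInt_congr (f := jetState a (fn u) (Gb.leftValues a b 0 (fn u))) (ae_vol_of_forall fun s hs => by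
    rw [← That_apply_add_Gv hGb 0 (memLp_fn u) hs, Matrix.mulVec_zero, add_zero])
    fun p => memLp_jet (memLp_fn u) _ _

theorem toL2_That (hGb : Gb.SquareIntegrable a b) (v : Fin nv → ℝ) (u : L2 a b (StateIdx n)) :
    PIEtoPDE a b Gb v u = toL2 a b ((Gb.That a b).apply a b (fn u))
      + toL2 a b (fun s => Gb.Gv a b s *ᵥ v) :=
  toL2_add (sqInt_That hGb u) (sqInt_Gv v)

theorem PIEtoPDE_mem_X (hab : a < b) (hGb : Gb.SquareIntegrable a b)
    (hadm : Gb.Admissible a b) (v : Fin nv → ℝ) (u : L2 a b (StateIdx n)) :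
    PIEtoPDE a b Gb v u ∈ Gb.X a b v :=
  (mem_X_iff hab hGb hadm (fn_PIEtoPDE hGb v u)).2 rfl

/-- A state in `X_v` is recovered from its highest derivatives. -/
theorem PIEtoPDE_DD (hab : a < b) (hGb : Gb.SquareIntegrable a b) (hadm : Gb.Admissible a b)
    {v : Fin nv → ℝ} {x : L2 a b (StateIdx n)} (hx : x ∈ Gb.X a b v) :
    PIEtoPDE a b Gb v (DD x) = x := by
  obtain ⟨c, hc⟩ := exists_jetState_of_mem_Wn hab hx.1
  have := (mem_X_iff hab hGb hadm hc).1 hx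
  refine ext_fn ?_
  filter_upwards [hc, fn_PIEtoPDE hGb v (DD x)] with s h1 h2
  rw [h1, h2, ← this]

end BCParams

end Jets

/-! ## Composition with the in-domain operators -/

section Split
variable {a b : ℝ} {ι κ : Type}

/-- The left endpoint is left out because `glue` takes its first kernel at the joint, so the
right-hand piece agrees only beyond it. -/
theorem vecInt_congr_Ioc (hab : a ≤ b) {f g : ℝ → ι → ℝ} (h : ∀ s ∈ Set.Ioc a b, f s = g s) :
    vecInt a b f = vecInt a b g := by
  ext i
  simp only [vecInt]
  rw [intervalIntegral.integral_of_le hab, intervalIntegral.integral_of_le hab]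
  exact setIntegral_congr_fun measurableSet_Ioc fun s hs => congrFun (h s hs) i

theorem matInt_congr_Ioc (hab : a ≤ b) {f g : ℝ → Matrix ι κ ℝ}
    (h : ∀ s ∈ Set.Ioc a b, f s = g s) : matInt a b f = matInt a b g := by
  ext i j
  simp only [matInt, Matrix.of_apply]
  rw [intervalIntegral.integral_of_le hab, intervalIntegral.integral_of_le hab]
  exact setIntegral_congr_fun measurableSet_Ioc fun s hs => congrFun (congrFun (h s hs) i) j

theorem matInt_add_adjacent {f : ℝ → Matrix ι κ ℝ}
    (hf : ∀ i j, Integrable (fun s => f s i j) (vol a b)) {s : ℝ} (hs : s ∈ Set.Icc a b) :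
    matInt a s f + matInt s b f = matInt a b f := by
  ext i j
  have hab := hs.1.trans hs.2
  exact intervalIntegral.integral_add_adjacent_intervals
    (intervalIntegrable_of_vol (hf i j) ⟨le_rfl, hab⟩ hs)
    (intervalIntegrable_of_vol (hf i j) hs ⟨hab, le_rfl⟩)

theorem matInt_add (hab : a ≤ b) {f g : ℝ → Matrix ι κ ℝ}
    (hf : ∀ i j, Integrable (fun s => f s i j) (vol a b))
    (hg : ∀ i j, Integrable (fun s => g s i j) (vol a b)) :
    matInt a b (fun s => f s + g s) = matInt a b f + matInt a b g := by
  ext i j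
  have hm : a ∈ Set.Icc a b := ⟨le_rfl, hab⟩
  have hm' : b ∈ Set.Icc a b := ⟨hab, le_rfl⟩
  exact intervalIntegral.integral_add (intervalIntegrable_of_vol (hf i j) hm hm')
    (intervalIntegrable_of_vol (hg i j) hm hm')

/-- The kernel equal to `f` on `[a,s]` and to `g` on `(s,b]`. -/
def glue (s : ℝ) (f g : ℝ → Matrix ι κ ℝ) (θ : ℝ) : Matrix ι κ ℝ := if θ ≤ s then f θ else g θ

theorem glue_of_le {s θ : ℝ} (f g : ℝ → Matrix ι κ ℝ) (h : θ ≤ s) : glue s f g θ = f θ :=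
  if_pos h

theorem glue_of_lt {s θ : ℝ} (f g : ℝ → Matrix ι κ ℝ) (h : s < θ) : glue s f g θ = g θ :=
  if_neg h.not_ge

theorem SqIntMat.glue {f g : ℝ → Matrix ι κ ℝ} (hf : SqIntMat a b f) (hg : SqIntMat a b g)
    (s : ℝ) : SqIntMat a b (glue s f g) := fun i j => by
  have h : (fun θ => GPDE.glue s f g θ i j)
      = (Set.Iic s).piecewise (fun θ => f θ i j) (fun θ => g θ i j) := by
    ext θ
    by_cases h : θ ≤ s
    · rw [glue_of_le f g h, Set.piecewise_eq_of_mem _ _ _ (Set.mem_Iic.2 h)]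
    · rw [glue_of_lt f g (not_le.1 h), Set.piecewise_eq_of_notMem _ _ _ (mt Set.mem_Iic.1 h)]
  rw [h]
  exact MemLp.piecewise measurableSet_Iic ((hf i j).restrict _) ((hg i j).restrict _)

/-- For fixed `s`, the two integral terms of a 3-PI operator become one functional on `[a,b]`, to
which `vecInt_mulVec_jet` applies. -/
theorem vecInt_glue [Fintype κ] {f g : ℝ → Matrix ι κ ℝ} (hf : SqIntMat a b f)
    (hg : SqIntMat a b g) {w : ℝ → κ → ℝ} (hw : ∀ k, MemLp (fun s => w s k) 2 (vol a b))
    {s : ℝ} (hs : s ∈ Set.Icc a b) :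
    vecInt a s (fun θ => f θ *ᵥ w θ) + vecInt s b (fun θ => g θ *ᵥ w θ)
      = vecInt a b (fun θ => glue s f g θ *ᵥ w θ) := by
  rw [← BCParams.vecInt_add_adjacent ((hf.glue hg s).integrable_mulVec hw) hs]
  congr 1
  · exact vecInt_congr_Ioc hs.1 fun θ hθ => by rw [glue_of_le f g hθ.2]
  · exact vecInt_congr_Ioc hs.2 fun θ hθ => by rw [glue_of_lt f g hθ.1]

theorem matInt_glue {μ : Type} [Fintype κ] {f g : ℝ → Matrix ι κ ℝ} (hf : SqIntMat a b f)
    (hg : SqIntMat a b g) {K : ℝ → Matrix κ μ ℝ} (hK : SqIntMat a b K)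
    {s : ℝ} (hs : s ∈ Set.Icc a b) :
    matInt a s (fun θ => f θ * K θ) + matInt s b (fun θ => g θ * K θ)
      = matInt a b (fun θ => glue s f g θ * K θ) := by
  rw [← matInt_add_adjacent ((hf.glue hg s).integrable_mul hK) hs]
  congr 1
  · exact matInt_congr_Ioc hs.1 fun θ hθ => by rw [glue_of_le f g hθ.2]
  · exact matInt_congr_Ioc hs.2 fun θ hθ => by rw [glue_of_lt f g hθ.1]

/-- Almost every slice of a null subset of the square is null, so the essential bound passes to
almost every slice. -/
theorem ae_memLp_top_slice {f : ℝ × ℝ → ℝ} (hf : MemLp f ⊤ ((vol a b).prod (vol a b))) :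
    ∀ᵐ s ∂(vol a b), MemLp (fun θ => f (s, θ)) ⊤ (vol a b) := by
  obtain ⟨C, hC⟩ : ∃ C : ℝ, ∀ᵐ z ∂((vol a b).prod (vol a b)), ‖f z‖ ≤ C :=
    ⟨_, ae_le_lpNorm_exponent_top hf⟩
  filter_upwards [hf.aestronglyMeasurable.prodMk_left, Measure.ae_ae_of_ae_prod hC] with s h1 h2
  exact memLp_top_of_bound h1 C h2

theorem ae_sqIntMat_slice [Finite ι] [Finite κ] {M : ℝ → ℝ → Matrix ι κ ℝ}
    (hM : ∀ i j, MemLp (fun z : ℝ × ℝ => M z.1 z.2 i j) ⊤ ((vol a b).prod (vol a b))) :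
    ∀ᵐ s ∂(vol a b), SqIntMat a b (M s) := by
  filter_upwards [ae_all_iff.2 fun i => ae_all_iff.2 fun j => ae_memLp_top_slice (hM i j)]
    with s hs i j
  exact memLp_two_of_top (hs i j)

end Split

/-! ### The parameters `Υ` and the product formula. -/

section Comp
variable {N : ℕ} {n : Fin (N + 1) → ℕ} {a b : ℝ} {nBC nv nr : ℕ} {Gb : BCParams n nBC nv}
  {ι : Type}

theorem TT_zero : TT n 0 = 1 :=
  Matrix.ext_of_mulVec_single fun i => by rw [TT_zero_mulVec, Matrix.one_mulVec]

namespace BCParams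

/-- Since `T(0) = 1`, the values at both ends take the common form `[T(0); T(b-a)]` times the values
at `a`, as in `boundaryValues`. -/
theorem Upsilon_P : (Gb.Upsilon a b).P = Matrix.fromRows 1
    (Matrix.fromRows (TT n 0) (TT n (b - a)) * (Gb.BTinv a b * Gb.Bv)) := by
  rw [Matrix.fromRows_mul, TT_zero, Matrix.one_mul, ← Matrix.mul_assoc]; rfl

theorem Upsilon_Q1 (s : ℝ) : (Gb.Upsilon a b).Q1 s = Matrix.fromRows 0
    (Matrix.fromRows (TT n 0) (TT n (b - a)) * Gb.BQ a b s + endKernel n b s) := by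
  rw [Matrix.fromRows_mul, TT_zero, Matrix.one_mul]
  ext (i | i | i) j <;> simp [Upsilon, endKernel]

theorem sqIntMat_Upsilon_R2 (η : ℝ) : SqIntMat a b (fun θ => (Gb.Upsilon a b).R.R2 θ η) :=
  ((sqIntMat_TT a b).const_mul _).mul_const _

theorem sqIntMat_Upsilon_R1 (η : ℝ) : SqIntMat a b (fun θ => (Gb.Upsilon a b).R.R1 θ η) :=
  (sqIntMat_Upsilon_R2 η).add ((sqIntMat_QQ_right a b η).const_mul _)

theorem sqIntMat_Upsilon_Q2 : SqIntMat a b (Gb.Upsilon a b).Q2 :=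
  (((sqIntMat_TT a b).const_mul _).mul_const _).mul_const _

theorem matInt_mul_Upsilon_Q2 (hab : a ≤ b) {C : ℝ → Matrix ι (DerivIdx n) ℝ}
    (hC : SqIntMat a b C) : matInt a b (fun s => C s * (Gb.Upsilon a b).Q2 s)
      = boundaryRow a b C * (Gb.BTinv a b * Gb.Bv) := by
  rw [boundaryRow, matInt_mul hab ((hC.mul_const _).integrable_mul (sqIntMat_TT a b))]
  simp only [Upsilon, Matrix.mul_assoc]

/-- `R_{D,1}` is `R_{D,2}` plus `U₂ Q`. The `R_{D,2}` parts join over `[a,b]` into the contribution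
of the left values; the `Q` part completes `kernelRow`. -/
theorem kernelRow_add_boundaryRow {C : ℝ → Matrix ι (DerivIdx n) ℝ}
    (hC : SqIntMat a b C) {η : ℝ} (hη : η ∈ Set.Icc a b) :
    C η * U1 n + matInt a η (fun θ => C θ * (Gb.Upsilon a b).R.R2 θ η)
        + matInt η b (fun θ => C θ * (Gb.Upsilon a b).R.R1 θ η)
      = kernelRow b C η + boundaryRow a b C * Gb.BQ a b η := by
  have hab := hη.1.trans hη.2
  have hCr := hC.mono hη.1 le_rfl
  have h1 := matInt_add hη.2 (hCr.integrable_mul ((sqIntMat_Upsilon_R2 (Gb := Gb) η).mono hη.1 le_rfl))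
    ((hCr.mul_const (U2 n)).integrable_mul (sqIntMat_QQ_right η b η))
  have h2 : ∀ θ, C θ * (Gb.Upsilon a b).R.R1 θ η
      = C θ * (Gb.Upsilon a b).R.R2 θ η + C θ * U2 n * QQ n (θ - η) := fun θ => by
    rw [Matrix.mul_assoc (C θ), ← Matrix.mul_add]; rfl
  have h3 := matInt_add_adjacent (hC.integrable_mul (sqIntMat_Upsilon_R2 (Gb := Gb) η)) hη
  have h4 : boundaryRow a b C * Gb.BQ a b η
      = matInt a b (fun θ => C θ * (Gb.Upsilon a b).R.R2 θ η) := by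
    rw [boundaryRow, matInt_mul hab ((hC.mul_const _).integrable_mul (sqIntMat_TT a b))]
    simp only [Upsilon, Matrix.mul_assoc]
  simp only [h2, h1, h4, ← h3, kernelRow]
  abel

end BCParams

/-- The output of the associated PIE. -/
theorem output_eq (hab : a ≤ b) (hGb : Gb.SquareIntegrable a b) {Gp : PDEParams n nv nr}
    (hC : SqIntMat a b Gp.Cr) (v : Fin nv → ℝ) {u : ℝ → StateIdx n → ℝ}
    (hu : ∀ p, MemLp (fun s => u s p) 2 (vol a b)) :
    vecInt a b (fun s => Gp.Cr s *ᵥ jet a u (Gb.leftValues a b v u) s)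
        + Gp.Drb *ᵥ boundaryValues a b u (Gb.leftValues a b v u)
      = vecInt a b (fun s => (toPIE a b Gb Gp).Cr s *ᵥ u s) + (toPIE a b Gb Gp).Drv *ᵥ v := by
  have hBQ := BCParams.sqIntMat_BQ hGb
  have hE := sqIntMat_endKernel (n := n) a b
  have hK := sqIntMat_kernelRow hC
  set E := Matrix.fromRows (TT n 0) (TT n (b - a)) with hEdef
  have hCr : ∀ s ∈ Set.Icc a b, (toPIE a b Gb Gp).Cr s = Gp.Drb * (E * Gb.BQ a b s)
      + Gp.Drb * endKernel n b s + kernelRow b Gp.Cr s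
      + boundaryRow a b Gp.Cr * Gb.BQ a b s := fun s hs => by
    have h := BCParams.kernelRow_add_boundaryRow (Gb := Gb) hC hs
    rw [add_assoc, ← h]
    simp only [toPIE, FourPI.comp, BCParams.Upsilon_Q1, PDEParams.Xi,
      Matrix.fromCols_mul_fromRows, Matrix.zero_mul, zero_add, Matrix.mul_add, ← hEdef]
    change _ + _ + Gp.Cr s * U1 n + _ + _ = _
    abel
  have hDrv : (toPIE a b Gb Gp).Drv = Gp.Drb * (E * (Gb.BTinv a b * Gb.Bv))
      + boundaryRow a b Gp.Cr * (Gb.BTinv a b * Gb.Bv) := by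
    rw [← BCParams.matInt_mul_Upsilon_Q2 hab hC]
    simp only [toPIE, FourPI.comp, BCParams.Upsilon_P, PDEParams.Xi,
      Matrix.fromCols_mul_fromRows, Matrix.zero_mul, zero_add, ← hEdef]
  have i1 := ((hBQ.const_mul E).const_mul Gp.Drb).integrable_mulVec hu
  have i2 := (hE.const_mul Gp.Drb).integrable_mulVec hu
  have i3 := hK.integrable_mulVec hu
  have i4 := (hBQ.const_mul (boundaryRow a b Gp.Cr)).integrable_mulVec hu
  have i12 := (((hBQ.const_mul E).const_mul Gp.Drb).add
    (hE.const_mul Gp.Drb)).integrable_mulVec hu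
  have i123 := ((((hBQ.const_mul E).const_mul Gp.Drb).add
    (hE.const_mul Gp.Drb)).add hK).integrable_mulVec hu
  simp only [Matrix.add_mulVec] at i12 i123
  have hint : vecInt a b (fun s => (toPIE a b Gb Gp).Cr s *ᵥ u s)
      = Gp.Drb *ᵥ (E *ᵥ vecInt a b (fun η => Gb.BQ a b η *ᵥ u η))
      + Gp.Drb *ᵥ vecInt a b (fun η => endKernel n b η *ᵥ u η)
      + vecInt a b (fun η => kernelRow b Gp.Cr η *ᵥ u η)
      + boundaryRow a b Gp.Cr *ᵥ vecInt a b (fun η => Gb.BQ a b η *ᵥ u η) := by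
    rw [vecInt_congr hab (g := fun s => (Gp.Drb * (E * Gb.BQ a b s)) *ᵥ u s
      + (Gp.Drb * endKernel n b s) *ᵥ u s + kernelRow b Gp.Cr s *ᵥ u s
      + (boundaryRow a b Gp.Cr * Gb.BQ a b s) *ᵥ u s)
      (ae_vol_of_forall fun s hs => by rw [hCr s hs]; simp only [Matrix.add_mulVec]),
      vecInt_add hab i123 i4, vecInt_add hab i12 i3, vecInt_add hab i1 i2]
    rw [mulVec_vecInt hab E (hBQ.integrable_mulVec hu),
      mulVec_vecInt hab _ (by simpa only [Matrix.mulVec_mulVec] using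
        (hBQ.const_mul E).integrable_mulVec hu),
      mulVec_vecInt hab _ (hE.integrable_mulVec hu),
      mulVec_vecInt hab _ (hBQ.integrable_mulVec hu)]
    simp only [Matrix.mulVec_mulVec]
  rw [hint, hDrv, vecInt_mulVec_jet hab hC hu, boundaryValues, ← hEdef, BCParams.leftValues]
  simp only [Matrix.mulVec_add, Matrix.add_mulVec, ← Matrix.mulVec_mulVec]
  abel

/-- The right-hand side of the associated PIE. -/
theorem dynamics_eq (hGb : Gb.SquareIntegrable a b) {Gp : PDEParams n nv nr}
    (v : Fin nv → ℝ) {u : ℝ → StateIdx n → ℝ}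
    (hu : ∀ p, MemLp (fun s => u s p) 2 (vol a b)) {s : ℝ} (hs : s ∈ Set.Icc a b)
    (h1 : SqIntMat a b (Gp.A.R1 s)) (h2 : SqIntMat a b (Gp.A.R2 s)) :
    Gp.A.apply a b (jet a u (Gb.leftValues a b v u)) s + Gp.Bxv s *ᵥ v
        + Gp.Bxb s *ᵥ boundaryValues a b u (Gb.leftValues a b v u)
      = (toPIE a b Gb Gp).A.apply a b u s + (toPIE a b Gb Gp).Bv s *ᵥ v := by
  have hab := hs.1.trans hs.2
  have hBQ := BCParams.sqIntMat_BQ hGb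
  have hE := sqIntMat_endKernel (n := n) a b
  set E := Matrix.fromRows (TT n 0) (TT n (b - a)) with hEdef
  set C := glue s (Gp.A.R1 s) (Gp.A.R2 s) with hCdef
  have hC : SqIntMat a b C := h1.glue h2 s
  have hK := sqIntMat_kernelRow hC
  set F := U2 n * TT n (s - a) with hF
  -- `L` is the kernel common to `R̂₁` and `R̂₂`. For `η ≤ s` there is one further term, from the
  -- Volterra remainder of `F x` at the point `s` itself.
  let L : ℝ → Matrix (StateIdx n) (StateIdx n) ℝ := fun η =>
    Gp.Bxb s * (E * Gb.BQ a b η) + Gp.Bxb s * endKernel n b η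
      + Gp.A.R0 s * (F * Gb.BQ a b η) + (kernelRow b C η + boundaryRow a b C * Gb.BQ a b η)
  have hR1 : ∀ η ∈ Set.Ioc a s, (toPIE a b Gb Gp).A.R1 s η
      = L η + Gp.A.R0 s * (U2 n * QQ n (s - η)) := fun η hη => by
    have hη' : η ∈ Set.Icc a b := ⟨hη.1.le, hη.2.trans hs.2⟩
    have hsη : s ∈ Set.Icc η b := ⟨hη.2, hs.2⟩
    -- For `η ≤ s` the range `[a,η]` lies left of the joint, where `C` is `A₁`; the ranges `[η,s]`
    -- and `[s,b]` are glued in `e2`.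
    have e1 : matInt a η (fun θ => Gp.A.R1 s θ * (Gb.Upsilon a b).R.R2 θ η)
        = matInt a η (fun θ => C θ * (Gb.Upsilon a b).R.R2 θ η) :=
      matInt_congr_Ioc hη'.1 fun θ hθ => by rw [hCdef, glue_of_le _ _ (hθ.2.trans hη.2)]
    have e2 := matInt_glue (h1.mono hη'.1 le_rfl) (h2.mono hη'.1 le_rfl)
      ((BCParams.sqIntMat_Upsilon_R1 (a := a) (b := b) (Gb := Gb) η).mono hη'.1 le_rfl) hsη
    have e3 : Gp.A.R1 s η = C η := (glue_of_le _ _ hη.2).symm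
    have e4 : (Gb.Upsilon a b).R.R1 s η = F * Gb.BQ a b η + U2 n * QQ n (s - η) := rfl
    simp only [L]
    rw [← BCParams.kernelRow_add_boundaryRow (Gb := Gb) hC hη', ← e1, ← e2, ← e3]
    simp only [toPIE, FourPI.comp, BCParams.Upsilon_Q1, PDEParams.Xi,
      Matrix.fromCols_mul_fromRows, Matrix.mul_zero, zero_add, Matrix.mul_add, ← hEdef, e4]
    change _ + _ + _ + Gp.A.R1 s η * U1 n + _ + _ + _ = _
    abel
  have hR2 : ∀ η ∈ Set.Ioc s b, (toPIE a b Gb Gp).A.R2 s η = L η := fun η hη => by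
    have hη' : η ∈ Set.Icc a b := ⟨hs.1.trans hη.1.le, hη.2⟩
    have hsη : s ∈ Set.Icc a η := ⟨hs.1, hη.1.le⟩
    -- Mirror case: `[η,b]` lies right of the joint, and the glued ranges are `[a,s]` and `[s,η]`.
    have e1 : matInt η b (fun θ => Gp.A.R2 s θ * (Gb.Upsilon a b).R.R1 θ η)
        = matInt η b (fun θ => C θ * (Gb.Upsilon a b).R.R1 θ η) :=
      matInt_congr_Ioc hη'.2 fun θ hθ => by rw [hCdef, glue_of_lt _ _ (hη.1.trans hθ.1)]
    have e2 := matInt_glue (h1.mono le_rfl hη'.2) (h2.mono le_rfl hη'.2)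
      ((BCParams.sqIntMat_Upsilon_R2 (a := a) (b := b) (Gb := Gb) η).mono le_rfl hη'.2) hsη
    have e3 : Gp.A.R2 s η = C η := (glue_of_lt _ _ hη.1).symm
    have e4 : (Gb.Upsilon a b).R.R2 s η = F * Gb.BQ a b η := rfl
    simp only [L]
    rw [← BCParams.kernelRow_add_boundaryRow (Gb := Gb) hC hη', ← e1, ← e2, ← e3]
    simp only [toPIE, FourPI.comp, BCParams.Upsilon_Q1, PDEParams.Xi,
      Matrix.fromCols_mul_fromRows, Matrix.mul_zero, zero_add, Matrix.mul_add, ← hEdef, e4]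
    change _ + _ + _ + Gp.A.R2 s η * U1 n + _ + _ + _ = _
    abel
  have hBv : (toPIE a b Gb Gp).Bv s = Gp.Bxv s + Gp.Bxb s * (E * (Gb.BTinv a b * Gb.Bv))
      + Gp.A.R0 s * (F * (Gb.BTinv a b * Gb.Bv))
      + boundaryRow a b C * (Gb.BTinv a b * Gb.Bv) := by
    have e4 : (Gb.Upsilon a b).Q2 s = F * (Gb.BTinv a b * Gb.Bv) := by
      rw [← Matrix.mul_assoc]; rfl
    rw [← BCParams.matInt_mul_Upsilon_Q2 hab hC, hCdef,
      ← matInt_glue h1 h2 BCParams.sqIntMat_Upsilon_Q2 hs]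
    simp only [toPIE, FourPI.comp, BCParams.Upsilon_P, PDEParams.Xi,
      Matrix.fromCols_mul_fromRows, Matrix.mul_one, ← hEdef, e4]
    abel
  have s1 := (hBQ.const_mul E).const_mul (Gp.Bxb s)
  have s2 := hE.const_mul (Gp.Bxb s)
  have s3 := (hBQ.const_mul F).const_mul (Gp.A.R0 s)
  have s5 := hBQ.const_mul (boundaryRow a b C)
  have hL : SqIntMat a b L := ((s1.add s2).add s3).add (hK.add s5)
  have i12 := (s1.add s2).integrable_mulVec hu
  have i123 := ((s1.add s2).add s3).integrable_mulVec hu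
  have i45 := (hK.add s5).integrable_mulVec hu
  simp only [Matrix.add_mulVec] at i12 i123 i45
  have hQi := (sqIntMat_QQ_left (n := n) a b s).integrable_mulVec hu
  have hBQi := hBQ.integrable_mulVec hu
  have hLint : vecInt a b (fun η => L η *ᵥ u η)
      = Gp.Bxb s *ᵥ (E *ᵥ vecInt a b (fun η => Gb.BQ a b η *ᵥ u η))
      + Gp.Bxb s *ᵥ vecInt a b (fun η => endKernel n b η *ᵥ u η)
      + Gp.A.R0 s *ᵥ (F *ᵥ vecInt a b (fun η => Gb.BQ a b η *ᵥ u η))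
      + (vecInt a b (fun η => kernelRow b C η *ᵥ u η)
      + boundaryRow a b C *ᵥ vecInt a b (fun η => Gb.BQ a b η *ᵥ u η)) := by
    simp only [L, Matrix.add_mulVec]
    rw [vecInt_add hab i123 i45, vecInt_add hab i12 (s3.integrable_mulVec hu),
      vecInt_add hab (s1.integrable_mulVec hu) (s2.integrable_mulVec hu),
      vecInt_add hab (hK.integrable_mulVec hu) (s5.integrable_mulVec hu)]
    rw [mulVec_vecInt hab E hBQi,
      mulVec_vecInt hab _ (by simpa only [Matrix.mulVec_mulVec] using
        (hBQ.const_mul E).integrable_mulVec hu),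
      mulVec_vecInt hab _ (hE.integrable_mulVec hu), mulVec_vecInt hab F hBQi,
      mulVec_vecInt hab _ (by simpa only [Matrix.mulVec_mulVec] using
        (hBQ.const_mul F).integrable_mulVec hu), mulVec_vecInt hab _ hBQi]
    simp only [Matrix.mulVec_mulVec]
  have hA : (toPIE a b Gb Gp).A.apply a b u s = Gp.A.R0 s *ᵥ (U1 n *ᵥ u s)
      + vecInt a b (fun η => L η *ᵥ u η)
      + Gp.A.R0 s *ᵥ (U2 n *ᵥ vecInt a s (fun η => QQ n (s - η) *ᵥ u η)) := by
    have hus : ∀ p, MemLp (fun s => u s p) 2 (vol a s) := fun p =>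
      (hu p).mono_measure (Measure.restrict_mono (Set.Icc_subset_Icc_right hs.2) le_rfl)
    have hQs := sqIntMat_QQ_left (n := n) a s s
    rw [ThreePI.apply, vecInt_congr_Ioc hs.1 (g := fun η => L η *ᵥ u η
        + (Gp.A.R0 s * (U2 n * QQ n (s - η))) *ᵥ u η)
        fun η hη => by rw [hR1 η hη, Matrix.add_mulVec],
      vecInt_congr_Ioc hs.2 (g := fun η => L η *ᵥ u η) fun η hη => by rw [hR2 η hη],
      vecInt_add hs.1 ((hL.mono le_rfl hs.2).integrable_mulVec hus)
        (((hQs.const_mul _).const_mul _).integrable_mulVec hus),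
      ← BCParams.vecInt_add_adjacent (hL.integrable_mulVec hu) hs,
      mulVec_vecInt hs.1 (U2 n) (hQs.integrable_mulVec hus),
      mulVec_vecInt hs.1 _ (by simpa only [Matrix.mulVec_mulVec] using
        (hQs.const_mul (U2 n)).integrable_mulVec hus)]
    simp only [Matrix.mulVec_mulVec]
    change (Gp.A.R0 s * U1 n) *ᵥ u s + _ + _ = _
    abel
  have hlhs : Gp.A.apply a b (jet a u (Gb.leftValues a b v u)) s
      = Gp.A.R0 s *ᵥ jet a u (Gb.leftValues a b v u) s
        + vecInt a b (fun θ => C θ *ᵥ jet a u (Gb.leftValues a b v u) θ) := by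
    rw [ThreePI.apply, add_assoc, vecInt_glue h1 h2 (memLp_jet hu _) hs]
  rw [hlhs, hA, hBv, hLint, vecInt_mulVec_jet hab hC hu, boundaryValues, ← hEdef, jet, taylor,
    BCParams.leftValues]
  simp only [Matrix.mulVec_add, Matrix.add_mulVec, ← Matrix.mulVec_mulVec, hF]
  abel

theorem ThreePI.apply_congr {p q : Type} [Fintype q] (R : ThreePI p q) {f g : ℝ → q → ℝ}
    (h : ∀ᵐ s ∂(vol a b), f s = g s) : ∀ᵐ s ∂(vol a b), R.apply a b f s = R.apply a b g s := by
  filter_upwards [h, ae_restrict_mem measurableSet_Icc] with s h1 hs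
  simp only [ThreePI.apply, h1]
  congr 1
  · congr 1
    exact vecInt_congr hs.1 (ae_restrict_of_ae_restrict_of_subset (Set.Icc_subset_Icc_right hs.2)
      (h.mono fun η hη => by rw [hη]))
  · exact vecInt_congr hs.2 (ae_restrict_of_ae_restrict_of_subset (Set.Icc_subset_Icc_left hs.1)
      (h.mono fun η hη => by rw [hη]))

end Comp

/-! ## Equivalence of the PDE and the PIE -/

section Main
variable {N : ℕ} {n : Fin (N + 1) → ℕ} {a b : ℝ} {nBC nv nr : ℕ} {Gb : BCParams n nBC nv}

theorem padFirst_mul {κ μ : Type} [Fintype κ] (M : Matrix (CoreIdx n) κ ℝ) (K : Matrix κ μ ℝ) :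
    padFirst (M * K) = padFirst M * K := by
  ext p c
  simp only [padFirst, Matrix.of_apply, Matrix.mul_apply]
  split_ifs <;> simp

namespace BCParams

/-- `T_v` factors through `B_v`, so regularity of `B_v v` suffices although `v` itself is only in
`L_{2e}`. -/
theorem Gv_mulVec (s : ℝ) (v : Fin nv → ℝ) :
    Gb.Gv a b s *ᵥ v = padFirst (TT n (s - a) * Gb.BTinv a b) *ᵥ (Gb.Bv *ᵥ v) := by
  rw [Gv, padFirst_mul, Matrix.mulVec_mulVec]

theorem sqInt_padFirst (w : Fin nBC → ℝ) :
    SqInt a b (fun s => padFirst (TT n (s - a) * Gb.BTinv a b) *ᵥ w) := by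
  intro p
  refine memLp_two_of_top (memLp_top_of_continuous a b ?_)
  simp only [padFirst_mulVec, ← Matrix.mulVec_mulVec]
  split_ifs
  · exact continuous_finsetSum _ fun q' _ =>
      ((continuous_TT _ q').comp (continuous_id.sub continuous_const)).mul continuous_const
  · exact continuous_const

variable (a b Gb) in
/-- The map `B_v v ↦ T_v v`. -/
def inputMap : (Fin nBC → ℝ) →ₗ[ℝ] L2 a b (StateIdx n) where
  toFun w := toL2 a b (fun s => padFirst (TT n (s - a) * Gb.BTinv a b) *ᵥ w)
  map_add' w w' := by
    simp only [Matrix.mulVec_add]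
    exact toL2_add (sqInt_padFirst w) (sqInt_padFirst w')
  map_smul' c w := by
    simp only [Matrix.mulVec_smul]
    exact toL2_smul c (sqInt_padFirst w)

theorem toL2_Gv (v : Fin nv → ℝ) :
    toL2 a b (fun s => Gb.Gv a b s *ᵥ v) = Gb.inputMap a b (Gb.Bv *ᵥ v) := by
  simp only [Gv_mulVec]; rfl

/-- A linear map from a finite-dimensional space is continuous, so the chain rule gives the
derivative in L₂. -/
theorem exists_hasDerivWithinAt_Gv {v : ℝ → Fin nv → ℝ} {t : ℝ}
    (h : DifferentiableAt ℝ (fun t => Gb.Bv *ᵥ v t) t) : ∃ Tv' : L2 a b (StateIdx n),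
    HasDerivWithinAt (fun τ => toL2 a b (fun s => Gb.Gv a b s *ᵥ v τ)) Tv' (Set.Ici 0) t := by
  simp only [toL2_Gv]
  exact ⟨_, ((Gb.inputMap a b).toContinuousLinearMap.hasFDerivAt.comp_hasDerivAt t
    h.hasDerivAt).hasDerivWithinAt⟩

end BCParams

/-- The right-hand side and the output of the PDE and of the PIE agree. -/
theorem rhs_eq (hab : a < b) (hGb : Gb.SquareIntegrable a b) {Gp : PDEParams n nv nr}
    (hGp : Gp.EssBounded a b) {v : Fin nv → ℝ} {x u : L2 a b (StateIdx n)}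
    (h : PIEtoPDE a b Gb v u = x) :
    (∀ᵐ s ∂(vol a b), Gp.A.apply a b (FF x) s + Gp.Bxv s *ᵥ v + Gp.Bxb s *ᵥ BB x
      = (toPIE a b Gb Gp).A.apply a b (fn u) s + (toPIE a b Gb Gp).Bv s *ᵥ v) ∧
    vecInt a b (fun s => Gp.Cr s *ᵥ FF x s) + Gp.Drb *ᵥ BB x
      = vecInt a b (fun s => (toPIE a b Gb Gp).Cr s *ᵥ fn u s)
        + (toPIE a b Gb Gp).Drv *ᵥ v := by
  subst h
  have hj := BCParams.fn_PIEtoPDE hGb v u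
  have hF := FF_eq_jet hab.le hj
  rw [BB_eq_boundaryValues hab hj]
  constructor
  · filter_upwards [Gp.A.apply_congr hF, ae_sqIntMat_slice hGp.A1, ae_sqIntMat_slice hGp.A2,
      ae_restrict_mem measurableSet_Icc] with s h1 h2 h3 hs
    rw [h1, dynamics_eq hGb v (memLp_fn u) hs h2 h3]
  · rw [← output_eq hab.le hGb (fun i j => memLp_two_of_top (hGp.Cr i j)) v (memLp_fn u),
      vecInt_congr hab.le (hF.mono fun s hs => by rw [hs])]

theorem isPIESolution_of_isPDESolution (hab : a < b) (hGb : Gb.SquareIntegrable a b)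
    {Gp : PDEParams n nv nr} (hGp : Gp.EssBounded a b) (hadm : Gb.Admissible a b)
    {v : ℝ → Fin nv → ℝ} {x0 : L2 a b (StateIdx n)} {x : ℝ → L2 a b (StateIdx n)}
    {r : ℝ → Fin nr → ℝ} (h : IsPDESolution a b Gb Gp x0 v x r) :
    IsPIESolution a b (toPIE a b Gb Gp) (DD x0) v (fun t => DD (x t)) r := by
  obtain ⟨-, hv, hBv, hr, hX, hx0, hdyn⟩ := h
  have hrec : ∀ t, 0 ≤ t → PIEtoPDE a b Gb (v t) (DD (x t)) = x t := fun t ht =>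
    BCParams.PIEtoPDE_DD hab hGb hadm (hX t ht)
  refine ⟨hv, fun s _ => ?_, hr, by simp only [hx0], fun t _ => BCParams.sqInt_That hGb _,
    fun t _ => BCParams.sqInt_Gv (v t), ?_⟩
  · have := hBv.mulVec (padFirst (TT n (s - a) * Gb.BTinv a b))
    simp only [← BCParams.Gv_mulVec] at this
    exact this
  · filter_upwards [hdyn, ae_differentiable_of_memW1e hBv, ae_restrict_mem measurableSet_Ici]
      with t ⟨x', hx', heq, hout⟩ hd ht
    obtain ⟨Tv', hTv'⟩ := BCParams.exists_hasDerivWithinAt_Gv (a := a) (b := b) hd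
    -- The reconstruction `x = T̂ D x + T_v v` holds only for times in `[0,∞)`, which is enough for
    -- a derivative within that set.
    have hT : ∀ τ ∈ Set.Ici (0 : ℝ), toL2 a b ((Gb.That a b).apply a b (fn (DD (x τ))))
        = x τ - toL2 a b (fun s => Gb.Gv a b s *ᵥ v τ) := fun τ hτ => by
      rw [eq_sub_iff_add_eq, ← BCParams.toL2_That hGb, hrec τ hτ]
    obtain ⟨h1, h2⟩ := rhs_eq hab hGb hGp (hrec t ht)
    refine ⟨x' - Tv', Tv', (hx'.sub hTv').congr hT (hT t ht), hTv', ?_, ?_⟩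
    · filter_upwards [h1, heq, fn_sub x' Tv'] with s e1 e2 e3
      rw [e3, e2, e1]
    · rw [hout, h2]

theorem isPDESolution_of_isPIESolution (hab : a < b) (hGb : Gb.SquareIntegrable a b)
    {Gp : PDEParams n nv nr} (hGp : Gp.EssBounded a b) (hadm : Gb.Admissible a b)
    {v : ℝ → Fin nv → ℝ} (hBv : MemW1e (fun t => Gb.Bv *ᵥ v t))
    {u0 : L2 a b (StateIdx n)} {u : ℝ → L2 a b (StateIdx n)}
    {r : ℝ → Fin nr → ℝ} (h : IsPIESolution a b (toPIE a b Gb Gp) u0 v u r) :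
    IsPDESolution a b Gb Gp (PIEtoPDE a b Gb (v 0) u0) v
      (fun t => PIEtoPDE a b Gb (v t) (u t)) r := by
  obtain ⟨hv, -, hr, hu0, -, -, hdyn⟩ := h
  refine ⟨BCParams.PIEtoPDE_mem_X hab hGb hadm _ _, hv, hBv, hr,
    fun t _ => BCParams.PIEtoPDE_mem_X hab hGb hadm _ _, by simp only [hu0], ?_⟩
  filter_upwards [hdyn] with t ⟨Tx', Tv', hT, hTv, heq, hout⟩
  obtain ⟨h1, h2⟩ := rhs_eq hab hGb hGp (v := v t) (u := u t) rfl
  -- Both derivatives exist by the definition of a PIE solution; in their sum the term `-∂ₜ(T_v v)`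
  -- cancels.
  refine ⟨Tx' + Tv', ?_, ?_, ?_⟩
  · simp only [BCParams.toL2_That hGb]
    exact hT.add hTv
  · filter_upwards [h1, heq, fn_add Tx' Tv'] with s e1 e2 e3
    rw [e3, e2, e1, sub_add_cancel]
  · rw [hout, h2]

end Main

end

end GPDE

theorem theorem2 {N : ℕ} (n : Fin (N + 1) → ℕ) {nBC nv nr : ℕ} {a b : ℝ} (hab : a < b)
    (Gb : GPDE.BCParams n nBC nv) (Gp : GPDE.PDEParams n nv nr)
    (hGb : Gb.SquareIntegrable a b) (hGp : Gp.EssBounded a b)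
    (hadm : Gb.Admissible a b)
    (v : ℝ → Fin nv → ℝ) (hv : GPDE.MemL2e v)
    (hBv : GPDE.MemW1e (fun t => Gb.Bv.mulVec (v t))) :
    (∀ x0 ∈ Gb.X a b (v 0), ∀ (x : ℝ → GPDE.L2 a b (GPDE.StateIdx n)) (r : ℝ → Fin nr → ℝ),
      GPDE.IsPDESolution a b Gb Gp x0 v x r →
        GPDE.IsPIESolution a b (GPDE.toPIE a b Gb Gp) (GPDE.DD x0) v
          (fun t => GPDE.DD (x t)) r) ∧
    (∀ (u0 : GPDE.L2 a b (GPDE.StateIdx n)) (u : ℝ → GPDE.L2 a b (GPDE.StateIdx n))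
      (r : ℝ → Fin nr → ℝ),
      GPDE.IsPIESolution a b (GPDE.toPIE a b Gb Gp) u0 v u r →
        GPDE.IsPDESolution a b Gb Gp (GPDE.PIEtoPDE a b Gb (v 0) u0) v
          (fun t => GPDE.PIEtoPDE a b Gb (v t) (u t)) r) :=
  ⟨fun _ _ _ _ h => GPDE.isPIESolution_of_isPDESolution hab hGb hGp hadm h,
    fun _ _ _ h => GPDE.isPDESolution_of_isPIESolution hab hGb hGp hadm hBv h⟩
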